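/- Let $D$ be a compact metric space, $E\subset\mathbb C$ compact, and $F\subset\widehat{\mathbb C}=\mathbb C\cup\{\infty\}$ closed with $E\cap F=\emptyset$; let $'$ denote the complement in $\widehat{\mathbb C}$. Let $\lambda,\mu$ be finite Borel measures on $D,E$, let $\nu$ be a Borel measure on $F$, and let $1\le p\le\infty$. A function $h$ is analytic at $\infty$ if $h(1/\zeta)$ is analytic at $\zeta=0$. For $U\subset\widehat{\mathbb C}$ open, $H(U)$ is the set of functions $h$ analytic on $U$ with $h(\infty)=0$ if $\infty\in U$. The Bergman space $H^p_\nu(F)$ is the closure in $L^p_\nu(F)$ of the functions in $L^p_\nu(F)$ that are restrictions of some $h\in H(U)$, $U\supset F$ open. Let $K\in C(D\times E)$ have an extension $K\in C(D\times F')$ such that $K(x,\cdot)$ is analytic in $F'$ for each $x\in D$. For $G\in C(D\times E)$ let $\mathcal G:L^2_\mu(E)\to L^2_\lambda(D)$ be the operator $\mathcal G[g](x)=\int_E G(x,y)g(y)\,\mathrm d\mu(y)$; its rank is the dimension of its range. The Grothendieck dual $\mathcal K':H^p_\nu(F)\to L^2_\lambda(D)$ is the bounded operator given by $$\mathcal K'[h](x)=\frac1{2\pi\mathrm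 i}\int_\Gamma K(x,\xi)\,h(\xi)\,\mathrm d\xi$$ for every $h\in H(U)$ with $h|_F\in L^p_\nu(F)$, every open $U\supset F$ with $U\cap E=\emptyset$, and every finite sum $\Gamma\subset U\setminus F$ of rectifiable Jordan curves whose winding number is constant on $F$ and constant on $U'$ (it is $0$ at $\infty$) with $\mathrm{Ind}_\Gamma(F)-\mathrm{Ind}_\Gamma(U')=1$. If no such bounded operator exists, put $\|\mathcal K'\|=\infty$. (If $\infty\in F$ or $K(\cdot,\infty)=0$, the integral does not depend on $\Gamma$; if $\infty\notin F$ and $\nu$ is finite, existence of $\mathcal K'$ requires $K(\cdot,\infty)=0$ $\lambda$-almost everywhere.) The Cauchy–Zolotarev number is $$Z_n\big(L^2_\mu(E),L^p_\nu(F)\big)=\inf_{\phi}\left\|\frac{\phi(z)^{-1}\phi(y)}{y-z}\right\|_{L^2_\mu(E)\to L^p_\nu(F)}\in[0,\infty],$$ where $\phi$ runs over the nonzero rational functions with numerator and denominator of degree at most $n$ for which $\phi$ is finite $\mu$-a.e. on $E$ and $1/\phi$ is finite $\nu$-a.e. on $F$; the norm is that of the integral operator with the given kernel (taken as $0$ at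 $z=\infty$), and is $\infty$ if this operator is not defined by absolutely convergent integrals or not bounded. Then for every $n\ge1$ such that $Z_n(L^2_\mu(E),L^p_\nu(F))$ and $\|\mathcal K'\|_{H^p_\nu(F)\to L^2_\lambda(D)}$ are finite there is a kernel $K_n\in C(D\times E)$ of rank at most $n$ with $$\|\mathcal K-\mathcal K_n\|_{L^2_\mu(E)\to L^2_\lambda(D)}\le Z_n\big(L^2_\mu(E),L^p_\nu(F)\big)\,\|\mathcal K'\|_{H^p_\nu(F)\to L^2_\lambda(D)}.$$ -/

import Mathlib

open MeasureTheory Set Topology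
open scoped ENNReal NNReal

noncomputable section

/-! ### Integral operators with continuous kernel -/

section KernelOp

variable {X Y : Type*} [MetricSpace X] [CompactSpace X]
  [MetricSpace Y] [CompactSpace Y] [MeasurableSpace Y] [BorelSpace Y]

theorem integrable_kernel_mul (μ : Measure Y) [IsFiniteMeasure μ] (K : C(X × Y, ℂ))
    (g : Lp ℂ 2 μ) (x : X) : Integrable (fun y => K (x, y) * g y) μ := by
  have hg : Integrable (fun y => g y) μ := (Lp.memLp g).integrable (by norm_num)
  refine hg.bdd_mul (c := ‖K‖) ?_ ?_
  · exact (K.continuous.comp (by fun_prop : Continuous fun y : Y => (x, y))).aestronglyMeasurable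
  · exact Filter.Eventually.of_forall fun y => K.norm_coe_le_norm _

/-- The continuous function `x ↦ ∫ K(x,y) g(y) dμ(y)`. -/
def kernelFun (μ : Measure Y) [IsFiniteMeasure μ] (K : C(X × Y, ℂ)) (g : Lp ℂ 2 μ) : C(X, ℂ) where
  toFun x := ∫ y, K (x, y) * g y ∂μ
  continuous_toFun := by
    have hg : Integrable (fun y => g y) μ := (Lp.memLp g).integrable (by norm_num)
    refine continuous_of_dominated (bound := fun y => ‖K‖ * ‖g y‖) ?_ ?_ ?_ ?_
    · exact fun x => (integrable_kernel_mul μ K g x).aestronglyMeasurable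
    · intro x
      refine Filter.Eventually.of_forall fun y => ?_
      rw [norm_mul]
      exact mul_le_mul_of_nonneg_right (K.norm_coe_le_norm _) (norm_nonneg _)
    · exact hg.norm.const_mul _
    · refine Filter.Eventually.of_forall fun y => ?_
      exact (K.continuous.comp (by fun_prop : Continuous fun x : X => (x, y))).mul
        continuous_const

theorem norm_kernelFun_le (μ : Measure Y) [IsFiniteMeasure μ] (K : C(X × Y, ℂ)) (g : Lp ℂ 2 μ) :
    ‖kernelFun μ K g‖ ≤ ‖K‖ * (μ univ ^ (1 / 2 : ℝ)).toReal * ‖g‖ := by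
  have hg : Integrable (fun y => g y) μ := (Lp.memLp g).integrable (by norm_num)
  have h1 : ∫ y, ‖g y‖ ∂μ ≤ (μ univ ^ (1 / 2 : ℝ)).toReal * ‖g‖ := by
    have h2 := eLpNorm_le_eLpNorm_mul_rpow_measure_univ (μ := μ) (p := 1) (q := 2)
      (by norm_num) (Lp.aestronglyMeasurable g)
    have h3 : (1 / (1 : ℝ≥0∞).toReal - 1 / (2 : ℝ≥0∞).toReal) = (1 / 2 : ℝ) := by norm_num
    rw [h3] at h2
    have h4 : μ univ ^ (1 / 2 : ℝ) ≠ ⊤ :=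
      ENNReal.rpow_ne_top_of_nonneg (by norm_num) (measure_ne_top μ _)
    have h5 := ENNReal.toReal_mono (ENNReal.mul_ne_top (Lp.eLpNorm_ne_top g) h4) h2
    rw [ENNReal.toReal_mul, ← Lp.norm_def] at h5
    rw [integral_norm_eq_lintegral_enorm hg.aestronglyMeasurable, ← eLpNorm_one_eq_lintegral_enorm,
      mul_comm]
    exact h5
  refine (ContinuousMap.norm_le _ (by positivity)).2 fun x => ?_
  calc ‖∫ y, K (x, y) * g y ∂μ‖ ≤ ∫ y, ‖K‖ * ‖g y‖ ∂μ := by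
        refine norm_integral_le_of_norm_le (hg.norm.const_mul _)
          (Filter.Eventually.of_forall fun y => ?_)
        rw [norm_mul]
        exact mul_le_mul_of_nonneg_right (K.norm_coe_le_norm _) (norm_nonneg _)
    _ = ‖K‖ * ∫ y, ‖g y‖ ∂μ := integral_const_mul _ _
    _ ≤ ‖K‖ * ((μ univ ^ (1 / 2 : ℝ)).toReal * ‖g‖) :=
        mul_le_mul_of_nonneg_left h1 (norm_nonneg _)
    _ = _ := by ring

/-- The integral operator `L²_μ(Y) → L²_λ(X)`, `g ↦ ∫ K(·,y) g(y) dμ(y)`. -/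
def kernelOp [MeasurableSpace X] [BorelSpace X] (lam : Measure X) [IsFiniteMeasure lam] (μ : Measure Y) [IsFiniteMeasure μ]
    (K : C(X × Y, ℂ)) : Lp ℂ 2 μ →L[ℂ] Lp ℂ 2 lam :=
  (ContinuousMap.toLp 2 lam ℂ).comp <|
    LinearMap.mkContinuous
      { toFun := kernelFun μ K
        map_add' := fun g₁ g₂ => by
          ext x
          change ∫ y, K (x, y) * (g₁ + g₂ : Lp ℂ 2 μ) y ∂μ
            = (∫ y, K (x, y) * g₁ y ∂μ) + ∫ y, K (x, y) * g₂ y ∂μ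
          rw [← integral_add (integrable_kernel_mul μ K g₁ x) (integrable_kernel_mul μ K g₂ x)]
          refine integral_congr_ae ?_
          filter_upwards [Lp.coeFn_add g₁ g₂] with y hy
          rw [hy, Pi.add_apply, mul_add]
        map_smul' := fun c g => by
          ext x
          rw [RingHom.id_apply]
          change ∫ y, K (x, y) * (c • g : Lp ℂ 2 μ) y ∂μ = c * ∫ y, K (x, y) * g y ∂μ
          rw [← integral_const_mul]
          refine integral_congr_ae ?_
          filter_upwards [Lp.coeFn_smul c g] with y hy
          rw [hy, Pi.smul_apply, smul_eq_mul]
          ring }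
      (‖K‖ * (μ univ ^ (1 / 2 : ℝ)).toReal) (norm_kernelFun_le μ K)

end KernelOp

/-! ### The Riemann sphere -/

instance : MeasurableSpace (OnePoint ℂ) := borel _

instance : BorelSpace (OnePoint ℂ) := ⟨rfl⟩

/-- `ζ ↦ 1/ζ` as a map from `ℂ` to the sphere, with `1/0 = ∞`. -/
def sphereInv (ζ : ℂ) : OnePoint ℂ := if ζ = 0 then OnePoint.infty else ((ζ⁻¹ : ℂ) : OnePoint ℂ)

/-- Analyticity at a point of the sphere; at `∞` it is analyticity of `f(1/ζ)` at `ζ = 0`. -/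
def SphereAnalyticAt (f : OnePoint ℂ → ℂ) : OnePoint ℂ → Prop
  | none => AnalyticAt ℂ (fun ζ => f (sphereInv ζ)) 0
  | some w => AnalyticAt ℂ (fun ζ : ℂ => f (ζ : OnePoint ℂ)) w

/-- `H(U)`: functions analytic on `U` that vanish at `∞` if `∞ ∈ U`. -/
def MemH (U : Set (OnePoint ℂ)) (h : OnePoint ℂ → ℂ) : Prop :=
  (∀ z ∈ U, SphereAnalyticAt h z) ∧ (OnePoint.infty ∈ U → h OnePoint.infty = 0)

/-! ### Contours -/

/-- A rectifiable Jordan curve in `ℂ`, given by a Lipschitz parametrization on `[0,1]`. -/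
structure JordanCurve where
  toFun : ℝ → ℂ
  lipschitz : ∃ C : ℝ≥0, LipschitzOnWith C toFun (Icc 0 1)
  closed : toFun 0 = toFun 1
  injOn : InjOn toFun (Ico 0 1)

/-- A finite sum of rectifiable Jordan curves (with their orientations). -/
abbrev Contour := List JordanCurve

/-- `∫_Γ f(ξ) dξ`. -/
def Contour.integral (Γ : Contour) (f : ℂ → ℂ) : ℂ :=
  (Γ.map fun γ => ∫ t in (0 : ℝ)..1, f (γ.toFun t) * deriv γ.toFun t).sum

/-- The winding number of `Γ` about a point of the sphere off `Γ`; it is `0` about `∞`. -/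
def Contour.index (Γ : Contour) : OnePoint ℂ → ℂ
  | none => 0
  | some w => (2 * Real.pi * Complex.I)⁻¹ * Γ.integral fun ξ => (ξ - w)⁻¹

/-- `Γ ⊂ U \ F`, and the winding numbers of `Γ` are constant on `F` and on the complement of `U`,
with `Ind_Γ(F) - Ind_Γ(Uᶜ) = 1`. -/
def Contour.Admissible (Γ : Contour) (F U : Set (OnePoint ℂ)) : Prop :=
  (∀ γ ∈ Γ, ∀ t ∈ Icc (0 : ℝ) 1, (γ.toFun t : OnePoint ℂ) ∈ U \ F) ∧
  ∃ a : ℤ, (∀ z ∈ F, Γ.index z = a + 1) ∧ ∀ w ∉ U, Γ.index w = a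

/-! ### The Bergman space and the Grothendieck dual operator -/

/-- `H^p_ν(F)`: the closure in `L^p_ν(F)` of the functions analytic on (a neighbourhood of) `F`. -/
def bergman (F : Set (OnePoint ℂ)) (p : ℝ≥0∞) [Fact (1 ≤ p)] (ν : Measure F) :
    Submodule ℂ (Lp ℂ p ν) :=
  (Submodule.span ℂ {u : Lp ℂ p ν | ∃ (U : Set (OnePoint ℂ)) (h : OnePoint ℂ → ℂ),
    IsOpen U ∧ F ⊆ U ∧ MemH U h ∧ u =ᵐ[ν] (fun z : F => h z)}).topologicalClosure

/-- `𝒦'[h](x) = (2πi)⁻¹ ∫_Γ K(x,ξ) h(ξ) dξ`. -/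
def dualFun {D : Type*} (K : D → OnePoint ℂ → ℂ) (Γ : Contour) (h : OnePoint ℂ → ℂ) (x : D) : ℂ :=
  (2 * Real.pi * Complex.I)⁻¹ * Γ.integral fun ξ => K x (ξ : OnePoint ℂ) * h (ξ : OnePoint ℂ)

/-- `T` is the operator `𝒦' : H^p_ν(F) → L²_λ(D)`: on every `h` analytic in an open
neighbourhood `U` of `F`, with `U` disjoint from `E`, it is given by the contour integral over
any admissible `Γ ⊂ U \ F`. It is determined by this, because such `h` are dense. -/
def IsGrothendieckDual {D : Type*} [MeasurableSpace D] (E : Set ℂ) (F : Set (OnePoint ℂ)) (p : ℝ≥0∞) [Fact (1 ≤ p)]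
    (ν : Measure F) (lam : Measure D) (K : D → OnePoint ℂ → ℂ)
    (T : bergman F p ν →L[ℂ] Lp ℂ 2 lam) : Prop :=
  ∀ (U : Set (OnePoint ℂ)) (h : OnePoint ℂ → ℂ) (Γ : Contour) (u : bergman F p ν),
    IsOpen U → F ⊆ U → (∀ y ∈ E, (y : OnePoint ℂ) ∉ U) → MemH U h → Γ.Admissible F U →
    (u : Lp ℂ p ν) =ᵐ[ν] (fun z : F => h z) → T u =ᵐ[lam] dualFun K Γ h

/-- `‖𝒦'‖` as an operator `H^p_ν(F) → L²_λ(D)`; it is `∞` if `𝒦'` is not a (well-defined)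
bounded operator. -/
def dualNorm {D : Type*} [MeasurableSpace D] (E : Set ℂ) (F : Set (OnePoint ℂ)) (p : ℝ≥0∞) [Fact (1 ≤ p)]
    (ν : Measure F) (lam : Measure D) (K : D → OnePoint ℂ → ℂ) : ℝ≥0∞ :=
  ⨅ (T : bergman F p ν →L[ℂ] Lp ℂ 2 lam) (_ : IsGrothendieckDual E F p ν lam K T), ‖T‖ₑ

/-! ### Cauchy–Zolotarev numbers -/

/-- The kernel `φ(z)⁻¹ φ(y) / (y - z)`, which is `0` at `z = ∞`. -/
def zolotarevKernel (φ : RatFunc ℂ) : OnePoint ℂ → ℂ → ℂ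
  | none, _ => 0
  | some z, y => (φ.eval (RingHom.id ℂ) z)⁻¹ * φ.eval (RingHom.id ℂ) y / (y - z)

/-- `φ` does not vanish at the point `z` of the sphere (it may have a pole there). -/
def NonvanishingAt (φ : RatFunc ℂ) : OnePoint ℂ → Prop
  | none => φ.denom.natDegree ≤ φ.num.natDegree
  | some z => φ.num.eval z ≠ 0

/-- The norm of the integral operator `L²_μ(Y) → L^p_ν(X)` with kernel `k`: the least constant
`M ∈ [0,∞]`; it is `∞` unless the defining integrals converge absolutely for every `g ∈ L²`. -/
def kernelNorm {X Y : Type*} [MeasurableSpace X] [MeasurableSpace Y] (p : ℝ≥0∞)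
    (μ : Measure Y) (ν : Measure X) (k : X → Y → ℂ) : ℝ≥0∞ :=
  sInf {M : ℝ≥0∞ | ∀ g : Y → ℂ, MemLp g 2 μ →
    (∀ᵐ z ∂ν, Integrable (fun y => k z y * g y) μ) ∧
    eLpNorm (fun z => ∫ y, k z y * g y ∂μ) p ν ≤ M * eLpNorm g 2 μ}

/-- The Cauchy–Zolotarev number `Z_n(L²_μ(E), L^p_ν(F))`: the infimum is over the nonzero rational
functions of type `(n,n)` for which `φ` is finite almost everywhere on `E` and `1/φ` almost
everywhere on `F`, so that the kernel makes sense. -/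
def cauchyZolotarev (n : ℕ) (E : Set ℂ) (F : Set (OnePoint ℂ)) (p : ℝ≥0∞)
    (μ : Measure E) (ν : Measure F) : ℝ≥0∞ :=
  ⨅ (φ : RatFunc ℂ) (_ : φ ≠ 0 ∧ φ.num.natDegree ≤ n ∧ φ.denom.natDegree ≤ n ∧
      (∀ᵐ y : E ∂μ, φ.denom.eval (y : ℂ) ≠ 0) ∧ ∀ᵐ z : F ∂ν, NonvanishingAt φ z),
    kernelNorm p μ ν fun (z : F) (y : E) => zolotarevKernel φ z y

end

/-! For g in L²_μ(E), let Cg(z) = ∫ g(y)/(y - z) dμ(y) be the Cauchy transform. It is analytic off E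
and vanishes at ∞, so it belongs to the Bergman space as soon as it is in L^p_ν(F). Fubini and
Cauchy's formula then give 𝒦'[Cg] = 𝒦g (`grothendieckDual_cauchyTransform`), hence ‖𝒦g‖ ≤ ‖𝒦'‖ ‖Cg‖.

If φ = P/Q has type (n,n), then (φ(y)/φ(z) - 1)/(y - z) is a sum of n products of a function of y
and a function of z, because the divided differences of P and Q are polynomials in z of degree less
than n. So C agrees with the Zolotarev operator on the common kernel of n functionals, and there
‖Cg‖ ≤ M‖g‖ for every bound M of that operator (`exists_eLpNorm_cauchyTransform_le`). In the
degenerate case where these functionals are not defined on all of L², ν lives on ∞ and the at most n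
poles of φ, and evaluating Cg at the poles gives the functionals instead.

Thus for every c' > c = Z_n ‖𝒦'‖ the bound ‖𝒦g‖ ≤ c'‖g‖ holds on a subspace cut out by n
functionals. By a min-max argument the compact operator 𝒦 has at most n singular values above c, and
𝒦_n is 𝒦 composed with the projection onto the corresponding singular vectors
(`exists_kernelOp_rank_le`). Passing through singular values gives the constant c itself although
the infima need not be attained. It also gives a continuous kernel: singular vectors lie in the
range of 𝒦†, which consists of continuous functions.

Since 𝒦' is specified by contour integrals, a contour separating E from F has to be constructed: it
is the boundary of the union of the squares of a fine grid that meet E, cut into simple cycles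
(`exists_separating_contour`). -/

noncomputable section

/-! ### Singular values of compact operators. -/

section HilbertSpace

variable {H₁ H₂ : Type*} [NormedAddCommGroup H₁] [InnerProductSpace ℂ H₁] [CompleteSpace H₁]
  [NormedAddCommGroup H₂] [InnerProductSpace ℂ H₂] [CompleteSpace H₂]

open ContinuousLinearMap Module.End

/-- The span of the eigenspaces of `T† T` with eigenvalue in `s`. -/
def singularSpace (T : H₁ →L[ℂ] H₂) (s : Set ℝ) : Submodule ℂ H₁ :=
  ⨆ t : s, eigenspace ((adjoint T ∘L T : H₁ →L[ℂ] H₁) : H₁ →ₗ[ℂ] H₁) ((t : ℝ) : ℂ)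

theorem inner_self_eq_ofReal_norm_sq {H : Type*} [NormedAddCommGroup H] [InnerProductSpace ℂ H]
    (x : H) : (inner ℂ x x : ℂ) = ((‖x‖ ^ 2 : ℝ) : ℂ) := by
  rw [inner_self_eq_norm_sq_to_K]
  simp

theorem inner_adjoint_comp_self (T : H₁ →L[ℂ] H₂) (x y : H₁) :
    inner ℂ ((adjoint T ∘L T) x) y = inner ℂ (T x) (T y) := by
  simp [adjoint_inner_left]

theorem isSymmetric_adjoint_comp_self (T : H₁ →L[ℂ] H₂) :
    ((adjoint T ∘L T : H₁ →L[ℂ] H₁) : H₁ →ₗ[ℂ] H₁).IsSymmetric := fun x y => by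
  simp [adjoint_inner_left, adjoint_inner_right]

theorem singularSpace_mono (T : H₁ →L[ℂ] H₂) {s t : Set ℝ} (h : s ⊆ t) :
    singularSpace T s ≤ singularSpace T t :=
  iSup_le fun a => le_iSup (fun t : t => eigenspace
    ((adjoint T ∘L T : H₁ →L[ℂ] H₁) : H₁ →ₗ[ℂ] H₁) ((t : ℝ) : ℂ)) ⟨a, h a.2⟩

/-- An eigenvector v with eigenvalue t ≠ 0 is T†(t⁻¹ T v). For kernel operators this makes singular
vectors continuous. -/
theorem singularSpace_le_range_adjoint (T : H₁ →L[ℂ] H₂) {s : Set ℝ} (h : ∀ t ∈ s, t ≠ 0) :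
    singularSpace T s ≤ LinearMap.range (adjoint T : H₂ →ₗ[ℂ] H₁) := by
  refine iSup_le fun t v hv => ?_
  rw [mem_eigenspace_iff] at hv
  have ht : ((t : ℝ) : ℂ) ≠ 0 := by exact_mod_cast h t t.2
  refine ⟨((t : ℝ) : ℂ)⁻¹ • T v, ?_⟩
  have h2 : adjoint T (T v) = ((t : ℝ) : ℂ) • v := hv
  rw [coe_coe, map_smul, h2, smul_smul, inv_mul_cancel₀ ht, one_smul]

/-- Eigenvectors of T†T with different eigenvalues are orthogonal, and so are their images under T.
Pythagoras on both sides compares the sums of ‖v_t‖² and t‖v_t‖². -/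
theorem mul_norm_sq_le_of_mem_singularSpace (T : H₁ →L[ℂ] H₂) {m : ℝ} {g : H₁}
    (hg : g ∈ singularSpace T (Ici m)) : m * ‖g‖ ^ 2 ≤ ‖T g‖ ^ 2 := by
  obtain ⟨f, hf, rfl⟩ := (Submodule.mem_iSup_iff_exists_finsupp _ _).1 hg
  have hfam := (isSymmetric_adjoint_comp_self T).orthogonalFamily_eigenspaces.comp
    (γ := Ici m) (f := fun t => ((t : ℝ) : ℂ))
    (fun a b hab => Subtype.ext (Complex.ofReal_injective hab))
  have hort : ∀ i j : Ici m, i ≠ j → inner ℂ (f i) (f j) = 0 := fun i j hij =>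
    hfam hij ⟨f i, hf i⟩ ⟨f j, hf j⟩
  have hB : ∀ i, (adjoint T ∘L T) (f i) = (((i : ℝ) : ℂ)) • f i := fun i =>
    mem_eigenspace_iff.1 (hf i)
  have h1 : (inner ℂ (f.sum fun _ x => x) (f.sum fun _ x => x) : ℂ) =
      ∑ i ∈ f.support, ((‖f i‖ ^ 2 : ℝ) : ℂ) := by
    rw [Finsupp.sum, sum_inner]
    refine Finset.sum_congr rfl fun i hi => ?_
    rw [inner_sum, Finset.sum_eq_single_of_mem i hi fun j _ hj => hort i j hj.symm,
      inner_self_eq_ofReal_norm_sq]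
  have h2 : (inner ℂ (T (f.sum fun _ x => x)) (T (f.sum fun _ x => x)) : ℂ) =
      ∑ i ∈ f.support, (((i : ℝ) * ‖f i‖ ^ 2 : ℝ) : ℂ) := by
    rw [← inner_adjoint_comp_self, Finsupp.sum, map_sum, sum_inner]
    refine Finset.sum_congr rfl fun i hi => ?_
    rw [hB, inner_sum, Finset.sum_eq_single_of_mem i hi fun j _ hj => by
      rw [inner_smul_left, hort i j hj.symm, mul_zero], inner_smul_left,
      inner_self_eq_ofReal_norm_sq]
    simp
  rw [inner_self_eq_ofReal_norm_sq] at h1 h2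
  change m * ‖f.sum fun _ x => x‖ ^ 2 ≤ ‖T (f.sum fun _ x => x)‖ ^ 2
  have h1' : ‖f.sum fun _ x => x‖ ^ 2 = ∑ i ∈ f.support, ‖f i‖ ^ 2 := by exact_mod_cast h1
  have h2' : ‖T (f.sum fun _ x => x)‖ ^ 2 = ∑ i ∈ f.support, (i : ℝ) * ‖f i‖ ^ 2 := by
    exact_mod_cast h2
  rw [h1', h2', Finset.mul_sum]
  exact Finset.sum_le_sum fun i _ => mul_le_mul_of_nonneg_right i.2 (sq_nonneg _)

/-- T†T restricts to a compact self-adjoint operator on the orthogonal complement. Its nonzero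
spectrum consists of eigenvalues, and one above c² would have an eigenvector both in the span and
orthogonal to it. So its norm, which is its spectral radius, is at most c², and ‖Tg‖² = ⟨T†Tg, g⟩.
-/
theorem norm_le_of_mem_orthogonal_singularSpace (T : H₁ →L[ℂ] H₂) (hT : IsCompactOperator T)
    {c : ℝ} (hc : 0 ≤ c) {g : H₁} (hg : g ∈ (singularSpace T (Ioi (c ^ 2)))ᗮ) :
    ‖T g‖ ≤ c * ‖g‖ := by
  set B : H₁ →L[ℂ] H₁ := adjoint T ∘L T with hBdef
  set W := singularSpace T (Ioi (c ^ 2)) with hW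
  have hsymm : (B : H₁ →ₗ[ℂ] H₁).IsSymmetric := isSymmetric_adjoint_comp_self T
  have hBc : IsCompactOperator B := hT.clm_comp (adjoint T)
  have hinv : ∀ v ∈ W, B v ∈ W := fun v hv => by
    refine Submodule.iSup_induction _ (motive := fun v => B v ∈ W) hv (fun t v hv => ?_) ?_ ?_
    · have h : B v = ((t : ℝ) : ℂ) • v := mem_eigenspace_iff.1 hv
      rw [h]
      exact W.smul_mem _ (Submodule.mem_iSup_of_mem t hv)
    · simp
    · intro x y hx hy
      rw [map_add]
      exact W.add_mem hx hy
  have hinv' : ∀ v ∈ Wᗮ, B v ∈ Wᗮ := fun v hv => by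
    rw [Submodule.mem_orthogonal] at hv ⊢
    exact fun u hu => (hsymm u v).symm.trans (hv _ (hinv u hu))
  let S : Wᗮ →L[ℂ] Wᗮ := B.restrict hinv'
  have hSc : IsCompactOperator S := hBc.restrict' hinv'
  have hSs : S.IsSymmetric := hsymm.restrict_invariant hinv'
  have hev : ∀ k ∈ spectrum ℂ S, ‖k‖ ≤ c ^ 2 := fun k hk => by
    rcases eq_or_ne k 0 with rfl | hk0
    · simpa using sq_nonneg c
    have hek := (hSc.hasEigenvalue_iff_mem_spectrum hk0).2 hk
    obtain ⟨v, hv, hv0⟩ := hek.exists_hasEigenvector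
    have hv1 : S v = k • v := mem_eigenspace_iff.1 hv
    have hv2 : B (v : H₁) = k • (v : H₁) := congrArg Subtype.val hv1
    have hkr : (starRingEnd ℂ) k = k := hSs.conj_eigenvalue_eq_self hek
    obtain ⟨r, rfl⟩ := Complex.conj_eq_iff_real.1 hkr
    have hvpos : 0 < ‖(v : H₁)‖ ^ 2 := by
      have : (v : H₁) ≠ 0 := fun h => hv0 (Subtype.ext h)
      positivity
    have hr0 : 0 ≤ r := by
      have h1 : (inner ℂ (B (v : H₁)) (v : H₁) : ℂ) = inner ℂ (T v) (T v) :=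
        inner_adjoint_comp_self T v v
      rw [hv2, inner_smul_left, inner_self_eq_ofReal_norm_sq, inner_self_eq_ofReal_norm_sq] at h1
      have h2 : r * ‖(v : H₁)‖ ^ 2 = ‖T v‖ ^ 2 := by
        rw [Complex.conj_ofReal] at h1
        exact_mod_cast h1
      by_contra hneg
      nlinarith [sq_nonneg ‖T v‖]
    rw [Complex.norm_real, Real.norm_of_nonneg hr0]
    by_contra hlt
    have hvW : (v : H₁) ∈ W :=
      Submodule.mem_iSup_of_mem (⟨r, lt_of_not_ge hlt⟩ : Ioi (c ^ 2)) (mem_eigenspace_iff.2 hv2)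
    have h0 : (inner ℂ (v : H₁) (v : H₁) : ℂ) = 0 := (Submodule.mem_orthogonal _ _).1 v.2 v hvW
    exact hv0 (Subtype.ext (inner_self_eq_zero.1 h0))
  have hnorm : ‖S‖ ≤ c ^ 2 := by
    have h1 : ((‖S‖₊ : ℝ≥0) : ℝ≥0∞) ≤ ((c ^ 2).toNNReal : ℝ≥0) := by
      rw [← S.spectralRadius_eq_nnnorm hSs.isSelfAdjoint, spectralRadius]
      refine iSup₂_le fun k hk => ?_
      exact ENNReal.coe_le_coe.2 (NNReal.le_toNNReal_of_coe_le (hev k hk))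
    have h2 := NNReal.coe_le_coe.2 (ENNReal.coe_le_coe.1 h1)
    rwa [Real.coe_toNNReal _ (sq_nonneg c)] at h2
  have h3 : ‖B g‖ ≤ c ^ 2 * ‖g‖ := (S.le_opNorm ⟨g, hg⟩).trans
    (mul_le_mul_of_nonneg_right hnorm (norm_nonneg _))
  have h4 : ‖T g‖ ^ 2 ≤ ‖B g‖ * ‖g‖ := by
    have := norm_inner_le_norm (𝕜 := ℂ) (B g) g
    rw [inner_adjoint_comp_self, inner_self_eq_norm_sq_to_K] at this
    simpa using this
  refine le_of_sq_le_sq ?_ (by positivity)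
  calc ‖T g‖ ^ 2 ≤ ‖B g‖ * ‖g‖ := h4
    _ ≤ c ^ 2 * ‖g‖ * ‖g‖ := mul_le_mul_of_nonneg_right h3 (norm_nonneg _)
    _ = (c * ‖g‖) ^ 2 := by ring

/-- If `T` is almost bounded by `c` on kernels of `n` functionals, then `T† T` has at most
`n` eigenvalues above `c²`. -/
theorem rank_singularSpace_le (T : H₁ →L[ℂ] H₂) {c : ℝ} (hc : 0 ≤ c) (n : ℕ)
    (h : ∀ c' > c, ∃ l : H₁ →ₗ[ℂ] (Fin n → ℂ), ∀ g, l g = 0 → ‖T g‖ ≤ c' * ‖g‖) :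
    Module.rank ℂ (singularSpace T (Ioi (c ^ 2))) ≤ n := by
  refine rank_le fun s hs => ?_
  by_contra! hcard
  -- A vector of the span involves finitely many eigenvalues, so these stay above some m > c². This
  -- gap leaves room for a c' > c.
  have hone : ∀ v : singularSpace T (Ioi (c ^ 2)), ∃ m : Ioi (c ^ 2),
      (v : H₁) ∈ singularSpace T (Ici (m : ℝ)) := fun ⟨v, hv⟩ => by
    refine Submodule.iSup_induction _
      (motive := fun v => ∃ m : Ioi (c ^ 2), v ∈ singularSpace T (Ici (m : ℝ))) hv ?_ ?_ ?_
    · exact fun t v hv => ⟨t, Submodule.mem_iSup_of_mem (⟨t, self_mem_Ici⟩ : Ici (t : ℝ)) hv⟩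
    · exact ⟨⟨c ^ 2 + 1, by simp⟩, Submodule.zero_mem _⟩
    · rintro x y ⟨m, hx⟩ ⟨m', hy⟩
      refine ⟨min m m', Submodule.add_mem _ ?_ ?_⟩
      · exact singularSpace_mono T (Ici_subset_Ici.2 (min_le_left m m')) hx
      · exact singularSpace_mono T (Ici_subset_Ici.2 (min_le_right m m')) hy
  choose mf hmf using hone
  obtain ⟨m, hm⟩ : ∃ m : Ioi (c ^ 2), ∀ v ∈ s, m ≤ mf v := by
    obtain ⟨v, -, hv⟩ := s.exists_min_image mf (Finset.card_pos.1 (by omega))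
    exact ⟨mf v, hv⟩
  have hmc : c < Real.sqrt m := Real.lt_sqrt_of_sq_lt m.2
  obtain ⟨c', hc1, hc2⟩ := exists_between hmc
  obtain ⟨l, hl⟩ := h c' hc1
  set X : Submodule ℂ (singularSpace T (Ioi (c ^ 2))) := Submodule.span ℂ (s : Set _)
  have hXfin : Module.finrank ℂ X = s.card := by
    have := finrank_span_eq_card hs
    rwa [Subtype.range_coe_subtype, Finset.setOfPred_mem, Fintype.card_coe] at this
  have : FiniteDimensional ℂ X := FiniteDimensional.span_finset ℂ s
  -- More than n independent vectors span a space on which n functionals have a common nonzero zero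
  -- x. Then √m ‖x‖ ≤ ‖Tx‖ ≤ c'‖x‖ contradicts c' < √m.
  have hker : LinearMap.ker ((l ∘ₗ (singularSpace T (Ioi (c ^ 2))).subtype) ∘ₗ X.subtype) ≠ ⊥ :=
    LinearMap.ker_ne_bot_of_finrank_lt (by simpa [hXfin] using hcard)
  obtain ⟨x, hx, hx0⟩ := Submodule.exists_mem_ne_zero_of_ne_bot hker
  have hxm : ((x : singularSpace T (Ioi (c ^ 2))) : H₁) ∈ singularSpace T (Ici (m : ℝ)) := by
    have hsub : X ≤ (singularSpace T (Ici (m : ℝ))).comap (Submodule.subtype _) :=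
      Submodule.span_le.2 fun v hv => singularSpace_mono T (Ici_subset_Ici.2 (hm v hv)) (hmf v)
    exact hsub x.2
  have h1 := mul_norm_sq_le_of_mem_singularSpace T hxm
  have h2 := hl _ (LinearMap.mem_ker.1 hx)
  set g : H₁ := ((x : singularSpace T (Ioi (c ^ 2))) : H₁)
  have hg : 0 < ‖g‖ := norm_pos_iff.2 fun h0 => hx0 (Subtype.ext (Subtype.ext h0))
  have h3 : c' ^ 2 < m := (Real.lt_sqrt (hc.trans hc1.le)).1 hc2
  have h4 : ‖T g‖ ^ 2 ≤ (c' * ‖g‖) ^ 2 := pow_le_pow_left₀ (norm_nonneg _) h2 2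
  have h5 : 0 < ‖g‖ ^ 2 := by positivity
  nlinarith

end HilbertSpace

/-! ### Compactness, adjoints and truncation of kernel operators. -/

section KernelOperators

variable {X Y : Type*} [MetricSpace X] [CompactSpace X] [MeasurableSpace X] [BorelSpace X]
  [MetricSpace Y] [CompactSpace Y] [MeasurableSpace Y] [BorelSpace Y]

theorem kernelOp_apply (lam : Measure X) [IsFiniteMeasure lam] (μ : Measure Y) [IsFiniteMeasure μ]
    (K : C(X × Y, ℂ)) (g : Lp ℂ 2 μ) :
    kernelOp lam μ K g = ContinuousMap.toLp 2 lam ℂ (kernelFun μ K g) := rfl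

theorem coeFn_kernelOp (lam : Measure X) [IsFiniteMeasure lam] (μ : Measure Y) [IsFiniteMeasure μ]
    (K : C(X × Y, ℂ)) (g : Lp ℂ 2 μ) :
    kernelOp lam μ K g =ᵐ[lam] fun x => ∫ y, K (x, y) * g y ∂μ :=
  ContinuousMap.coeFn_toLp (p := 2) (𝕜 := ℂ) lam (kernelFun μ K g)

/-- Kernel operators map bounded sets to equicontinuous sets, hence are compact. -/
theorem isCompactOperator_kernelOp (lam : Measure X) [IsFiniteMeasure lam] (μ : Measure Y)
    [IsFiniteMeasure μ] (K : C(X × Y, ℂ)) : IsCompactOperator (kernelOp lam μ K) := by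
  set A : Set (BoundedContinuousFunction X ℂ) :=
    (fun g => BoundedContinuousFunction.mkOfCompact (kernelFun μ K g)) '' Metric.closedBall 0 1
    with hA
  set c : ℝ := (μ univ ^ (1 / 2 : ℝ)).toReal with hc
  have hc0 : 0 ≤ c := ENNReal.toReal_nonneg
  have hcpt : IsCompact (closure A) := by
    refine BoundedContinuousFunction.arzela_ascoli (Metric.closedBall 0 (‖K‖ * c))
      (isCompact_closedBall _ _) A ?_ ?_
    · rintro _ x ⟨g, hg, rfl⟩
      rw [mem_closedBall_zero_iff] at hg ⊢
      have h1 := (kernelFun μ K g).norm_coe_le_norm x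
      have h2 := norm_kernelFun_le μ K g
      have h3 : ‖K‖ * c * ‖g‖ ≤ ‖K‖ * c * 1 := by gcongr
      calc _ ≤ _ := h1
        _ ≤ _ := h2
        _ ≤ _ := h3
        _ = _ := mul_one _
    · intro x₀
      rw [Metric.equicontinuousAt_iff_right]
      intro ε hε
      have hcurry : ContinuousAt K.curry x₀ := K.curry.continuous.continuousAt
      rw [Metric.continuousAt_iff'] at hcurry
      filter_upwards [hcurry (ε / (c + 1)) (by positivity)] with x hx
      rintro ⟨_, g, hg, rfl⟩
      rw [mem_closedBall_zero_iff] at hg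
      -- The difference of two slices of K, viewed as a kernel constant in its first variable, so
      -- that `norm_kernelFun_le` bounds the oscillation uniformly in g.
      let K' : C(X × Y, ℂ) := (K.curry x₀ - K.curry x).comp ⟨Prod.snd, continuous_snd⟩
      have hK' : ‖K'‖ ≤ ‖K.curry x - K.curry x₀‖ := by
        refine (ContinuousMap.norm_le _ (norm_nonneg _)).2 fun q => ?_
        rw [norm_sub_rev]
        exact (K.curry x₀ - K.curry x).norm_coe_le_norm q.2
      have hdiff : kernelFun μ K g x₀ - kernelFun μ K g x = kernelFun μ K' g x := by
        change (∫ y, K (x₀, y) * g y ∂μ) - ∫ y, K (x, y) * g y ∂μ = ∫ y, _ ∂μ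
        rw [← integral_sub (integrable_kernel_mul μ K g x₀) (integrable_kernel_mul μ K g x)]
        refine integral_congr_ae (Filter.Eventually.of_forall fun y => ?_)
        change _ = (K (x₀, y) - K (x, y)) * g y
        ring
      rw [dist_eq_norm] at hx
      change dist (kernelFun μ K g x₀) (kernelFun μ K g x) < ε
      rw [dist_eq_norm, hdiff]
      calc ‖kernelFun μ K' g x‖ ≤ ‖kernelFun μ K' g‖ := ContinuousMap.norm_coe_le_norm _ _
        _ ≤ ‖K'‖ * c * ‖g‖ := norm_kernelFun_le μ K' g
        _ ≤ (ε / (c + 1)) * c * 1 := by gcongr; exact hK'.trans hx.le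
        _ < ε := by
          rw [mul_one, div_mul_eq_mul_div, div_lt_iff₀ (by positivity)]
          nlinarith
  let toC : BoundedContinuousFunction X ℂ → Lp ℂ 2 lam := fun f =>
    ContinuousMap.toLp 2 lam ℂ f.toContinuousMap
  have htoC : Continuous toC := by
    refine (ContinuousMap.toLp 2 lam ℂ).continuous.comp ?_
    exact (ContinuousMap.isometryEquivBoundedOfCompact X ℂ).symm.continuous
  refine (isCompactOperator_iff_image_closedBall_subset_compact
    (kernelOp lam μ K : Lp ℂ 2 μ →ₗ[ℂ] Lp ℂ 2 lam) one_pos).2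
    ⟨toC '' closure A, hcpt.image htoC, ?_⟩
  rintro _ ⟨g, hg, rfl⟩
  exact ⟨_, subset_closure ⟨g, hg, rfl⟩, rfl⟩

/-- The kernel `(y, x) ↦ conj K(x, y)`. -/
def conjKernel (K : C(X × Y, ℂ)) : C(Y × X, ℂ) where
  toFun q := starRingEnd ℂ (K (q.2, q.1))
  continuous_toFun := by fun_prop

open ContinuousLinearMap in
theorem adjoint_kernelOp (lam : Measure X) [IsFiniteMeasure lam] (μ : Measure Y)
    [IsFiniteMeasure μ] (K : C(X × Y, ℂ)) :
    adjoint (kernelOp lam μ K) = kernelOp μ lam (conjKernel K) := by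
  symm
  rw [eq_adjoint_iff]
  intro f g
  rw [L2.inner_def, L2.inner_def]
  have hf : Integrable (fun x => f x) lam := (Lp.memLp f).integrable (by norm_num)
  have hg : Integrable (fun y => g y) μ := (Lp.memLp g).integrable (by norm_num)
  have hint : Integrable (fun q : X × Y => K q * (starRingEnd ℂ (f q.1) * g q.2)) (lam.prod μ) := by
    have h1 : Integrable (fun x => starRingEnd ℂ (f x)) lam :=
      (Complex.conjLIE.toContinuousLinearEquiv.toContinuousLinearMap).integrable_comp hf
    refine (h1.mul_prod hg).bdd_mul (c := ‖K‖) K.continuous.aestronglyMeasurable ?_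
    exact Filter.Eventually.of_forall fun q => K.norm_coe_le_norm q
  calc ∫ y, inner ℂ (kernelOp μ lam (conjKernel K) f y) (g y) ∂μ
      = ∫ y, ∫ x, K (x, y) * (starRingEnd ℂ (f x) * g y) ∂lam ∂μ := by
        refine integral_congr_ae ?_
        filter_upwards [coeFn_kernelOp μ lam (conjKernel K) f] with y hy
        rw [hy, RCLike.inner_apply, ← integral_conj, ← integral_const_mul]
        refine integral_congr_ae (Filter.Eventually.of_forall fun x => ?_)
        simp only [conjKernel, ContinuousMap.coe_mk, map_mul, Complex.conj_conj]
        ring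
    _ = ∫ x, ∫ y, K (x, y) * (starRingEnd ℂ (f x) * g y) ∂μ ∂lam :=
        (integral_integral_swap hint).symm
    _ = ∫ x, inner ℂ (f x) (kernelOp lam μ K g x) ∂lam := by
        refine integral_congr_ae ?_
        filter_upwards [coeFn_kernelOp lam μ K g] with x hx
        rw [hx, RCLike.inner_apply, ← integral_mul_const]
        refine integral_congr_ae (Filter.Eventually.of_forall fun y => ?_)
        ring

/-- If a subspace consists of continuous functions, composing a kernel operator with the
projection onto it gives a kernel operator. -/
theorem exists_kernelOp_eq_comp_starProjection (lam : Measure X) [IsFiniteMeasure lam]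
    (μ : Measure Y) [IsFiniteMeasure μ] (K : C(X × Y, ℂ)) (W : Submodule ℂ (Lp ℂ 2 μ))
    [FiniteDimensional ℂ W]
    (hW : W ≤ LinearMap.range
      ((ContinuousMap.toLp 2 μ ℂ : C(Y, ℂ) →L[ℂ] Lp ℂ 2 μ) : C(Y, ℂ) →ₗ[ℂ] Lp ℂ 2 μ)) :
    ∃ Kn : C(X × Y, ℂ), kernelOp lam μ Kn = kernelOp lam μ K ∘L W.starProjection := by
  let b := stdOrthonormalBasis ℂ W
  have hex : ∀ i, ∃ f : C(Y, ℂ), ContinuousMap.toLp 2 μ ℂ f = (b i : Lp ℂ 2 μ) := fun i =>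
    hW (b i).2
  choose f hf using hex
  -- The kernel is Σ (𝒦b_i)(x) conj(f_i(y)), where f_i is a continuous representative of the
  -- orthonormal basis vector b_i.
  refine ⟨∑ i, ((kernelFun μ K (b i)).comp ⟨Prod.fst, continuous_fst⟩) *
    ((star (f i)).comp ⟨Prod.snd, continuous_snd⟩), ?_⟩
  ext1 g
  have hP : W.starProjection g = ∑ i, inner ℂ (b i : Lp ℂ 2 μ) g • (b i : Lp ℂ 2 μ) := by
    rw [Submodule.starProjection_apply, b.orthogonalProjectionOnto_apply_eq_sum]
    simp
  have hg : Integrable (fun y => g y) μ := (Lp.memLp g).integrable (by norm_num)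
  have hin : ∀ i, inner ℂ (b i : Lp ℂ 2 μ) g = ∫ y, starRingEnd ℂ (f i y) * g y ∂μ := fun i => by
    rw [L2.inner_def]
    refine integral_congr_ae ?_
    filter_upwards [ContinuousMap.coeFn_toLp (p := 2) (𝕜 := ℂ) μ (f i)] with y hy
    rw [← hf i, hy, RCLike.inner_apply]
    ring
  have hint : ∀ i, Integrable (fun y => starRingEnd ℂ (f i y) * g y) μ := fun i => by
    refine hg.bdd_mul (c := ‖f i‖) (by fun_prop) ?_
    refine Filter.Eventually.of_forall fun y => ?_
    rw [RCLike.norm_conj]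
    exact (f i).norm_coe_le_norm y
  rw [ContinuousLinearMap.comp_apply, hP, map_sum, kernelOp_apply]
  simp only [map_smul, kernelOp_apply]
  simp only [← map_smul, ← map_sum]
  congr 1
  ext x
  change ∫ y, _ * g y ∂μ = _
  simp only [ContinuousMap.sum_apply, ContinuousMap.mul_apply, ContinuousMap.comp_apply,
    ContinuousMap.coe_mk, ContinuousMap.star_apply, Finset.sum_mul, ContinuousMap.smul_apply,
    smul_eq_mul, hin]
  rw [integral_finsetSum]
  · refine Finset.sum_congr rfl fun i _ => ?_
    rw [← integral_mul_const]
    refine integral_congr_ae (Filter.Eventually.of_forall fun y => ?_)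
    simp only [starRingEnd_apply]
    ring
  · intro i _
    simpa only [mul_assoc, starRingEnd_apply] using (hint i).const_mul (kernelFun μ K (b i) x)

/-- If `kernelOp lam μ K` is bounded by constants arbitrarily close to `c` on subspaces of
codimension at most `n`, then it is within `c` of a kernel operator of rank at most `n`. -/
theorem exists_kernelOp_rank_le (lam : Measure X) [IsFiniteMeasure lam]
    (μ : Measure Y) [IsFiniteMeasure μ] (K : C(X × Y, ℂ)) {c : ℝ} (hc : 0 ≤ c) (n : ℕ)
    (h : ∀ c' > c, ∃ l : Lp ℂ 2 μ →ₗ[ℂ] (Fin n → ℂ), ∀ g, l g = 0 →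
      ‖kernelOp lam μ K g‖ ≤ c' * ‖g‖) :
    ∃ Kn : C(X × Y, ℂ), LinearMap.rank (kernelOp lam μ Kn : Lp ℂ 2 μ →ₗ[ℂ] Lp ℂ 2 lam) ≤ n ∧
      ‖kernelOp lam μ K - kernelOp lam μ Kn‖ ≤ c := by
  set W := singularSpace (kernelOp lam μ K) (Ioi (c ^ 2)) with hWdef
  have hrank : Module.rank ℂ W ≤ n := rank_singularSpace_le _ hc n h
  have : FiniteDimensional ℂ W :=
    Module.rank_lt_aleph0_iff.1 (hrank.trans_lt Cardinal.natCast_lt_aleph0)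
  -- The adjoint is again a kernel operator, so the singular vectors in its range have continuous
  -- representatives.
  obtain ⟨Kn, hKn⟩ := exists_kernelOp_eq_comp_starProjection lam μ K W <| by
    refine (singularSpace_le_range_adjoint _ fun t ht => ?_).trans ?_
    · exact ((sq_nonneg c).trans_lt ht).ne'
    · rw [adjoint_kernelOp]
      rintro _ ⟨f, rfl⟩
      exact ⟨kernelFun lam (conjKernel K) f, rfl⟩
  refine ⟨Kn, ?_, ?_⟩
  · rw [hKn]
    have hle : LinearMap.range ((kernelOp lam μ K ∘L W.starProjection : Lp ℂ 2 μ →L[ℂ] Lp ℂ 2 lam) :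
        Lp ℂ 2 μ →ₗ[ℂ] Lp ℂ 2 lam) ≤ W.map (kernelOp lam μ K : Lp ℂ 2 μ →ₗ[ℂ] Lp ℂ 2 lam) := by
      rintro _ ⟨g, rfl⟩
      exact ⟨W.starProjection g, W.starProjection_apply_mem g, rfl⟩
    have h2 := lift_rank_map_le (kernelOp lam μ K : Lp ℂ 2 μ →ₗ[ℂ] Lp ℂ 2 lam) W
    have h4 := h2.trans (Cardinal.lift_le_nat_iff.2 hrank)
    rw [Cardinal.lift_le_nat_iff] at h4
    exact (Submodule.rank_mono hle).trans h4
  · refine ContinuousLinearMap.opNorm_le_bound _ hc fun g => ?_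
    rw [hKn, sub_apply, ContinuousLinearMap.comp_apply, ← map_sub]
    have hmem : g - W.starProjection g ∈ Wᗮ := W.sub_starProjection_mem_orthogonal g
    refine (norm_le_of_mem_orthogonal_singularSpace _
      (isCompactOperator_kernelOp lam μ K) hc hmem).trans ?_
    gcongr
    have := Wᗮ.norm_starProjection_apply_le g
    rwa [Submodule.starProjection_orthogonal_val] at this

end KernelOperators

/-! ### Decomposition of balanced directed graphs into simple cycles. -/

section DirectedCycles

variable {V : Type*} [DecidableEq V]

/-- A finite set of directed edges is balanced if every vertex has as many incoming as outgoing
edges. -/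
def BalancedEdges (S : Finset (V × V)) : Prop := ∀ f : V → ℤ, ∑ e ∈ S, (f e.2 - f e.1) = 0

/-- Testing with the indicator of v counts incoming minus outgoing edges. Without an outgoing edge
the sum would be positive. -/
theorem BalancedEdges.exists_next {S : Finset (V × V)} (hS : BalancedEdges S) {u v : V}
    (h : (u, v) ∈ S) : ∃ w, (v, w) ∈ S := by
  by_contra! hno
  have h1 := hS fun w => if w = v then 1 else 0
  have h2 : ∑ e ∈ S, ((if e.2 = v then 1 else 0) - (if e.1 = v then 1 else 0) : ℤ) =
      ∑ e ∈ S, (if e.2 = v then 1 else 0) := by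
    refine Finset.sum_congr rfl fun e he => ?_
    have : e.1 ≠ v := fun h => hno e.2 (by rw [← h]; exact he)
    simp [this]
  rw [h2] at h1
  have h3 := (Finset.sum_eq_zero_iff_of_nonneg (fun e _ => by split_ifs <;> norm_num)).1 h1 _ h
  simp at h3

/-- A simple closed walk of length `k` through edges of `S`. -/
structure IsSimpleCycle (S : Finset (V × V)) (k : ℕ) (c : ℕ → V) : Prop where
  pos : 0 < k
  closed : c k = c 0
  injOn : InjOn c (Iio k)
  mem : ∀ i < k, (c i, c (i + 1)) ∈ S

/-- Choosing an outgoing edge at every vertex that has an incoming one gives a self-map of a finite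
set. It has a periodic point, and an orbit over one minimal period does not repeat a vertex. -/
theorem BalancedEdges.exists_isSimpleCycle {S : Finset (V × V)} (hS : BalancedEdges S)
    (hne : S.Nonempty) : ∃ k c, IsSimpleCycle S k c := by
  let R : Set V := {v | ∃ u, (u, v) ∈ S}
  have hRfin : R.Finite := by
    refine (S.image Prod.snd).finite_toSet.subset ?_
    rintro v ⟨u, hu⟩
    exact Finset.mem_coe.2 (Finset.mem_image.2 ⟨_, hu, rfl⟩)
  have : Finite R := hRfin
  have hnext : ∀ v : R, ∃ w : R, ((v : V), (w : V)) ∈ S := fun ⟨v, u, hu⟩ => by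
    obtain ⟨w, hw⟩ := hS.exists_next hu
    exact ⟨⟨w, v, hw⟩, hw⟩
  choose s hs using hnext
  obtain ⟨⟨u, v⟩, he⟩ := hne
  have hper : ∃ w : R, 0 < Function.minimalPeriod s w := by
    obtain ⟨i, j, hij, heq⟩ := Finite.exists_ne_map_eq_of_infinite fun i : ℕ => s^[i] ⟨v, u, he⟩
    wlog hlt : i < j generalizing i j
    · exact this j i hij.symm heq.symm (by omega)
    refine ⟨s^[i] ⟨v, u, he⟩, Function.IsPeriodicPt.minimalPeriod_pos (n := j - i) (by omega) ?_⟩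
    change s^[j - i] (s^[i] _) = _
    rw [← Function.iterate_add_apply, Nat.sub_add_cancel hlt.le]
    exact heq.symm
  obtain ⟨w, hw⟩ := hper
  refine ⟨Function.minimalPeriod s w, fun i => s^[i] w, hw, ?_, ?_, ?_⟩
  · simp only [Function.iterate_zero, id]
    rw [Function.iterate_minimalPeriod]
  · intro i hi j hj hij
    exact Function.iterate_injOn_Iio_minimalPeriod hi hj (Subtype.ext hij)
  · intro i _
    simp only [Function.iterate_succ_apply']
    exact hs _

/-- A cycle is balanced, so removing one leaves a smaller balanced set; induct on the number of
edges. -/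
theorem BalancedEdges.exists_cycles {S : Finset (V × V)} (hS : BalancedEdges S) :
    ∃ L : List (ℕ × (ℕ → V)), (∀ c ∈ L, IsSimpleCycle S c.1 c.2) ∧
      ∀ J : V × V → ℂ, ∑ e ∈ S, J e =
        (L.map fun c => ∑ i ∈ Finset.range c.1, J (c.2 i, c.2 (i + 1))).sum := by
  induction hn : S.card using Nat.strong_induction_on generalizing S with
  | _ n ih =>
    rcases S.eq_empty_or_nonempty with rfl | hne
    · exact ⟨[], by simp, by simp⟩
    obtain ⟨k, c, hc⟩ := hS.exists_isSimpleCycle hne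
    set C := (Finset.range k).image fun i => (c i, c (i + 1)) with hC
    have hinj : InjOn (fun i => (c i, c (i + 1))) (Finset.range k : Set ℕ) := fun i hi j hj hij =>
      hc.injOn (by simpa using hi) (by simpa using hj) (congrArg Prod.fst hij)
    have hCS : C ⊆ S := by
      intro e he
      obtain ⟨i, hi, rfl⟩ := Finset.mem_image.1 he
      exact hc.mem i (Finset.mem_range.1 hi)
    have hCb : BalancedEdges C := fun f => by
      rw [hC, Finset.sum_image hinj]
      simp only
      rw [Finset.sum_range_sub fun i => f (c i), hc.closed, sub_self]
    have hb : BalancedEdges (S \ C) := fun f => by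
      have h1 := Finset.sum_sdiff (f := fun e : V × V => f e.2 - f e.1) hCS
      rw [hS f, hCb f, add_zero] at h1
      exact h1
    have hlt : (S \ C).card < n := by
      rw [← hn]
      refine Finset.card_lt_card (Finset.sdiff_ssubset hCS ?_)
      exact ⟨_, Finset.mem_image_of_mem _ (Finset.mem_range.2 hc.pos)⟩
    obtain ⟨L, hL, hsum⟩ := ih _ hlt hb rfl
    refine ⟨(k, c) :: L, ?_, fun J => ?_⟩
    · intro d hd
      rcases List.mem_cons.1 hd with rfl | hd
      · exact hc
      · exact ⟨(hL d hd).pos, (hL d hd).closed, (hL d hd).injOn,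
          fun i hi => Finset.sdiff_subset ((hL d hd).mem i hi)⟩
    · rw [← Finset.sum_sdiff hCS, hsum J, List.map_cons, List.sum_cons, hC,
        Finset.sum_image hinj, add_comm]

/-- The edges of `S` whose reversal does not belong to `S`. -/
def reducedEdges (S : Finset (V × V)) : Finset (V × V) := S.filter fun e => e.swap ∉ S

/-- The discarded edges come in antiparallel pairs, whose terms cancel. Excluding loops makes
reversal free of fixed points. -/
theorem sum_reducedEdges {M : Type*} [AddCommGroup M] (S : Finset (V × V))
    (hloop : ∀ e ∈ S, e.1 ≠ e.2) (J : V × V → M)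
    (hJ : ∀ e, J e.swap = - J e) : ∑ e ∈ reducedEdges S, J e = ∑ e ∈ S, J e := by
  rw [← Finset.sum_filter_add_sum_filter_not S (fun e => e.swap ∉ S), reducedEdges,
    left_eq_add]
  refine Finset.sum_involution (fun e _ => e.swap) ?_ ?_ ?_ ?_
  · intro e _
    rw [hJ, add_neg_cancel]
  · intro e he _ h
    exact hloop e (Finset.mem_filter.1 he).1 (congrArg Prod.fst h).symm
  · intro e he
    have := Finset.mem_filter.1 he
    rw [not_not] at this
    exact Finset.mem_filter.2 ⟨this.2, by simpa using this.1⟩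
  · intro e _
    exact Prod.swap_swap e

theorem BalancedEdges.reducedEdges {S : Finset (V × V)} (hS : BalancedEdges S)
    (hloop : ∀ e ∈ S, e.1 ≠ e.2) : BalancedEdges (reducedEdges S) := fun f => by
  rw [sum_reducedEdges S hloop _ fun e => by simp, hS f]

end DirectedCycles

/-! ### Polygonal paths and integrals along them. -/

section Polyline

/-- The integral of `f` along the segment from `a` to `b`. -/
def edgeIntegral (f : ℂ → ℂ) (a b : ℂ) : ℂ := ∫ s in (0 : ℝ)..1, f (a + s * (b - a)) * (b - a)

theorem edgeIntegral_swap (f : ℂ → ℂ) (a b : ℂ) : edgeIntegral f b a = - edgeIntegral f a b := by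
  unfold edgeIntegral
  have h := intervalIntegral.integral_comp_sub_left (a := 0) (b := 1)
    (fun s : ℝ => f (a + s * (b - a)) * (b - a)) 1
  simp only [sub_self, sub_zero] at h
  rw [← h, ← intervalIntegral.integral_neg]
  congr 1
  ext s
  push_cast
  ring_nf

theorem segment_point_mem {a b : ℂ} {s : ℝ} (hs : s ∈ Icc (0 : ℝ) 1) :
    a + s * (b - a) ∈ segment ℝ a b := by
  rw [segment_eq_image']
  exact ⟨s, hs, by simp⟩

/-- The polygonal path through `P 0, …, P k`, parametrized on `[0, 1]`. -/
def polyline (P : ℕ → ℂ) (k : ℕ) (t : ℝ) : ℂ :=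
  -- The clamped coefficient runs from 0 to 1 while t crosses [i/k, (i+1)/k] and is constant
  -- elsewhere. The sum is therefore visibly Lipschitz.
  P 0 + ∑ i ∈ Finset.range k, (max 0 (min 1 (k * t - i)) : ℝ) • (P (i + 1) - P i)

theorem polyline_eq (P : ℕ → ℂ) {k i : ℕ} (hi : i < k) {t : ℝ} (h0 : i ≤ k * t)
    (h1 : k * t ≤ i + 1) :
    polyline P k t = P i + ((k * t - i : ℝ) : ℂ) * (P (i + 1) - P i) := by
  have hsub : Finset.range (i + 1) ⊆ Finset.range k := Finset.range_mono (by omega)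
  unfold polyline
  rw [← Finset.sum_subset hsub, Finset.sum_range_succ]
  · have h2 : ∑ j ∈ Finset.range i, (max 0 (min 1 (k * t - j)) : ℝ) • (P (j + 1) - P j) =
        ∑ j ∈ Finset.range i, (P (j + 1) - P j) := by
      refine Finset.sum_congr rfl fun j hj => ?_
      have hj' : (j : ℝ) + 1 ≤ i := by exact_mod_cast Finset.mem_range.1 hj
      rw [min_eq_left (by linarith), max_eq_right zero_le_one, one_smul]
    rw [h2, Finset.sum_range_sub, min_eq_right (by linarith), max_eq_right (by linarith)]
    simp only [Complex.real_smul]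
    ring
  · intro j _ hj
    have hj' : (i : ℝ) + 1 ≤ j := by
      exact_mod_cast Nat.succ_le_of_lt (by simpa using hj)
    rw [min_eq_right (by linarith), max_eq_left (by linarith), zero_smul]

theorem exists_lipschitzWith_polyline (P : ℕ → ℂ) (k : ℕ) : ∃ C, LipschitzWith C (polyline P k) := by
  -- The induction is on the number of summands only; the speed k stays fixed.
  have h : ∀ m : ℕ, ∃ C, LipschitzWith C fun t : ℝ => P 0 + ∑ i ∈ Finset.range m,
      (max 0 (min 1 (k * t - i)) : ℝ) • (P (i + 1) - P i) := by
    intro m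
    induction m with
    | zero => exact ⟨0, by simp⟩
    | succ m ih =>
      obtain ⟨C, hC⟩ := ih
      have h1 : LipschitzWith ‖(k : ℝ)‖₊ fun t : ℝ => (k : ℝ) * t - m := by
        refine LipschitzWith.of_dist_le_mul fun x y => ?_
        rw [dist_sub_right, dist_eq_norm, dist_eq_norm, ← mul_sub, norm_mul]
        simp
      have h2 := (ContinuousLinearMap.toSpanSingleton ℝ (P (m + 1) - P m)).lipschitz.comp
        ((h1.const_min 1).const_max 0)
      simp only [Finset.sum_range_succ, ← add_assoc]
      exact ⟨_, hC.add h2⟩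
  exact h k

theorem exists_floor_lt {k : ℕ} (hk : 0 < k) {t : ℝ} (ht : t ∈ Ico (0 : ℝ) 1) :
    ∃ i < k, (i : ℝ) ≤ k * t ∧ k * t < i + 1 := by
  have hk' : (0 : ℝ) < k := by exact_mod_cast hk
  have h0 : 0 ≤ k * t := mul_nonneg hk'.le ht.1
  refine ⟨⌊k * t⌋₊, ?_, Nat.floor_le h0, Nat.lt_floor_add_one _⟩
  rw [Nat.floor_lt h0]
  nlinarith [ht.2]

theorem polyline_one (P : ℕ → ℂ) {k : ℕ} (hk : 0 < k) : polyline P k 1 = P k := by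
  obtain ⟨m, rfl⟩ : ∃ m, k = m + 1 := ⟨k - 1, by omega⟩
  rw [polyline_eq P (Nat.lt_succ_self m) (by push_cast; linarith) (by push_cast; linarith)]
  push_cast
  ring

theorem polyline_zero (P : ℕ → ℂ) {k : ℕ} (hk : 0 < k) : polyline P k 0 = P 0 := by
  rw [polyline_eq P hk (by simp) (by simp)]
  simp

theorem polyline_mem_segment (P : ℕ → ℂ) {k : ℕ} (hk : 0 < k) {t : ℝ} (ht : t ∈ Icc (0 : ℝ) 1) :
    ∃ i < k, polyline P k t ∈ segment ℝ (P i) (P (i + 1)) := by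
  rcases ht.2.lt_or_eq with h | rfl
  · obtain ⟨i, hi, h0, h1⟩ := exists_floor_lt hk ⟨ht.1, h⟩
    refine ⟨i, hi, ?_⟩
    rw [polyline_eq P hi h0 h1.le]
    exact segment_point_mem ⟨by linarith, by linarith⟩
  · refine ⟨k - 1, by omega, ?_⟩
    rw [polyline_one P hk, Nat.sub_add_cancel hk]
    exact right_mem_segment _ _ _

/-- A closed polygonal path whose half-open edges are pairwise disjoint, as a Jordan curve. -/
def polylineCurve (P : ℕ → ℂ) (k : ℕ) (hk : 0 < k) (hcl : P k = P 0)
    (hinj : ∀ i < k, ∀ j < k, ∀ s ∈ Ico (0 : ℝ) 1, ∀ t ∈ Ico (0 : ℝ) 1,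
      P i + s * (P (i + 1) - P i) = P j + t * (P (j + 1) - P j) → i = j ∧ s = t) : JordanCurve where
  toFun := polyline P k
  lipschitz := (exists_lipschitzWith_polyline P k).imp fun _ h => h.lipschitzOnWith
  closed := by rw [polyline_zero P hk, polyline_one P hk, hcl]
  injOn := by
    intro s hs t ht hst
    obtain ⟨i, hi, hi0, hi1⟩ := exists_floor_lt hk hs
    obtain ⟨j, hj, hj0, hj1⟩ := exists_floor_lt hk ht
    rw [polyline_eq P hi hi0 hi1.le, polyline_eq P hj hj0 hj1.le] at hst
    obtain ⟨rfl, h⟩ := hinj i hi j hj _ ⟨by linarith, by linarith⟩ _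
      ⟨by linarith, by linarith⟩ hst
    have hk' : (0 : ℝ) < k := by exact_mod_cast hk
    exact mul_left_cancel₀ hk'.ne' (by linarith)

/-- On each open interval (i/k, (i+1)/k) the path is affine, with derivative k times the increment,
and the substitution s = kt - i gives the edge integral. The breakpoints form a null set. -/
theorem integral_polyline (P : ℕ → ℂ) {k : ℕ} (hk : 0 < k) (f : ℂ → ℂ)
    (hf : ∀ i < k, ContinuousOn f (segment ℝ (P i) (P (i + 1)))) :
    ∫ t in (0 : ℝ)..1, f (polyline P k t) * deriv (polyline P k) t =
      ∑ i ∈ Finset.range k, edgeIntegral f (P i) (P (i + 1)) := by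
  have hk' : (0 : ℝ) < k := by exact_mod_cast hk
  set G : ℕ → ℝ → ℂ := fun i s => f (P i + s * (P (i + 1) - P i)) * (P (i + 1) - P i) with hG
  have hGc : ∀ i < k, ContinuousOn (G i) (Icc 0 1) := fun i hi => by
    refine ContinuousOn.mul ?_ continuousOn_const
    exact (hf i hi).comp (by fun_prop) fun s hs => segment_point_mem hs
  have hle : ∀ i : ℕ, (i : ℝ) / k ≤ ((i + 1 : ℕ) : ℝ) / k := fun i => by
    push_cast
    gcongr
    linarith
  have hae : ∀ i < k, ∀ t ∈ Ioo ((i : ℝ) / k) (((i + 1 : ℕ) : ℝ) / k),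
      f (polyline P k t) * deriv (polyline P k) t = k * G i (k * t - i) := fun i hi t ht => by
    have hmem : ∀ u ∈ Ioo ((i : ℝ) / k) (((i + 1 : ℕ) : ℝ) / k),
        polyline P k u = P i + ((k * u - i : ℝ) : ℂ) * (P (i + 1) - P i) := fun u hu => by
      have h1 := (div_lt_iff₀ hk').1 hu.1
      have h2 := (lt_div_iff₀ hk').1 hu.2
      push_cast at h2
      exact polyline_eq P hi (by linarith) (by linarith)
    have hder : HasDerivAt (polyline P k) (k * (P (i + 1) - P i)) t := by
      have h1 : HasDerivAt (fun u : ℝ => P i + ((k * u - i : ℝ) : ℂ) * (P (i + 1) - P i))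
          (k * (P (i + 1) - P i)) t := by
        have h2 : HasDerivAt (fun u : ℝ => ((k * u - i : ℝ) : ℂ)) ((k : ℝ) : ℂ) t :=
          HasDerivAt.ofReal_comp (by
            simpa using ((hasDerivAt_id' t).const_mul (k : ℝ)).sub_const (i : ℝ))
        simpa using (h2.mul_const (P (i + 1) - P i)).const_add (P i)
      refine h1.congr_of_eventuallyEq ?_
      filter_upwards [isOpen_Ioo.mem_nhds ht] with u hu using hmem u hu
    rw [hder.deriv, hmem t ht]
    simp only [hG]
    ring
  have hGc' : ∀ i < k, ContinuousOn (fun t : ℝ => (k : ℂ) * G i (k * t - i))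
      (Icc ((i : ℝ) / k) (((i + 1 : ℕ) : ℝ) / k)) := fun i hi => by
    refine continuousOn_const.mul ((hGc i hi).comp (by fun_prop) fun t ht => ?_)
    have h1 := (div_le_iff₀ hk').1 ht.1
    have h2 := (le_div_iff₀ hk').1 ht.2
    push_cast at h2
    exact ⟨by linarith, by linarith⟩
  have hadj := intervalIntegral.sum_integral_adjacent_intervals (n := k) (μ := volume)
    (f := fun t => f (polyline P k t) * deriv (polyline P k) t) (a := fun i => (i : ℝ) / k)
    (fun i hi => by
      have h1 : IntervalIntegrable (fun t : ℝ => (k : ℂ) * G i (k * t - i)) volume ((i : ℝ) / k)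
          (((i + 1 : ℕ) : ℝ) / k) := by
        refine ContinuousOn.intervalIntegrable ?_
        rw [uIcc_of_le (hle i)]
        exact hGc' i hi
      refine h1.congr_uIoo ?_
      rw [uIoo_of_le (hle i)]
      exact fun t ht => (hae i hi t ht).symm)
  simp only [Nat.cast_zero, zero_div, div_self hk'.ne'] at hadj
  rw [← hadj]
  refine Finset.sum_congr rfl fun i hi => ?_
  rw [Finset.mem_range] at hi
  rw [intervalIntegral.integral_congr_Ioo_of_le (hle i) (hae i hi),
    intervalIntegral.integral_const_mul, intervalIntegral.integral_comp_mul_sub _ hk'.ne']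
  have h1 : (k : ℝ) * (i / k) - i = 0 := by field_simp; ring
  have h2 : (k : ℝ) * (((i + 1 : ℕ) : ℝ) / k) - i = 1 := by push_cast; field_simp; ring
  rw [h1, h2, Complex.real_smul, ← mul_assoc, Complex.ofReal_inv, Complex.ofReal_natCast,
    mul_inv_cancel₀ (by exact_mod_cast hk.ne'), one_mul]
  rfl

end Polyline

/-! ### The square grid. -/

section Grid

/-- The point of the square lattice of mesh `δ` with the given integer coordinates. -/
def gridPoint (δ : ℝ) (v : ℤ × ℤ) : ℂ := ⟨δ * v.1, δ * v.2⟩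

/-- The closed square of mesh `δ` with lower left corner at `q`. -/
def gridSquare (δ : ℝ) (q : ℤ × ℤ) : Set ℂ :=
  Icc (δ * q.1) (δ * (q.1 + 1)) ×ℂ Icc (δ * q.2) (δ * (q.2 + 1))

/-- The four sides of a square of the lattice, directed clockwise. -/
def squareEdges (q : ℤ × ℤ) : Finset ((ℤ × ℤ) × (ℤ × ℤ)) :=
  {(q, (q.1, q.2 + 1)), ((q.1, q.2 + 1), (q.1 + 1, q.2 + 1)),
    ((q.1 + 1, q.2 + 1), (q.1 + 1, q.2)), ((q.1 + 1, q.2), q)}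

/-- Two lattice points are neighbours. -/
def IsGridStep (u v : ℤ × ℤ) : Prop :=
  v = (u.1, u.2 + 1) ∨ v = (u.1 + 1, u.2) ∨ v = (u.1, u.2 - 1) ∨ v = (u.1 - 1, u.2)

theorem isGridStep_of_mem_squareEdges {q : ℤ × ℤ} {e : (ℤ × ℤ) × (ℤ × ℤ)} (he : e ∈ squareEdges q) :
    IsGridStep e.1 e.2 := by
  simp only [squareEdges, Finset.mem_insert, Finset.mem_singleton] at he
  obtain ⟨a, b⟩ := q
  rcases he with rfl | rfl | rfl | rfl <;> simp [IsGridStep]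

theorem IsGridStep.ne {u v : ℤ × ℤ} (h : IsGridStep u v) : u ≠ v := by
  obtain ⟨a, b⟩ := u
  rintro rfl
  simp only [IsGridStep, Prod.mk.injEq] at h
  omega

/-- With clockwise orientation a directed edge determines the square on its right. Adjacent squares
traverse their common side in opposite directions. -/
theorem disjoint_squareEdges {q q' : ℤ × ℤ} (h : q ≠ q') :
    Disjoint (squareEdges q) (squareEdges q') := by
  obtain ⟨a, b⟩ := q
  obtain ⟨a', b'⟩ := q'
  rw [Finset.disjoint_left]
  intro e he he'
  simp only [squareEdges, Finset.mem_insert, Finset.mem_singleton] at he he'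
  apply h
  rcases he with rfl | rfl | rfl | rfl <;>
    simp only [Prod.mk.injEq] at he' ⊢ <;> omega

theorem sum_squareEdges {M : Type*} [AddCommGroup M] (q : ℤ × ℤ)
    (J : (ℤ × ℤ) × (ℤ × ℤ) → M) : ∑ e ∈ squareEdges q, J e =
      J (q, (q.1, q.2 + 1)) + (J ((q.1, q.2 + 1), (q.1 + 1, q.2 + 1)) +
        (J ((q.1 + 1, q.2 + 1), (q.1 + 1, q.2)) + J ((q.1 + 1, q.2), q))) := by
  obtain ⟨a, b⟩ := q
  unfold squareEdges
  rw [Finset.sum_insert, Finset.sum_insert, Finset.sum_insert, Finset.sum_singleton] <;>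
    simp

theorem exists_swap_mem_squareEdges {q : ℤ × ℤ} {e : (ℤ × ℤ) × (ℤ × ℤ)} (he : e ∈ squareEdges q) :
    ∃ q', e.swap ∈ squareEdges q' := by
  obtain ⟨a, b⟩ := q
  simp only [squareEdges, Finset.mem_insert, Finset.mem_singleton] at he
  rcases he with rfl | rfl | rfl | rfl
  · exact ⟨(a - 1, b), by simp [squareEdges]⟩
  · exact ⟨(a, b + 1), by simp [squareEdges]⟩
  · exact ⟨(a + 1, b), by simp [squareEdges]⟩
  · exact ⟨(a, b - 1), by simp [squareEdges]⟩

theorem convex_gridSquare (δ : ℝ) (q : ℤ × ℤ) : Convex ℝ (gridSquare δ q) :=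
  ((convex_Icc _ _).linear_preimage Complex.reLm).inter
    ((convex_Icc _ _).linear_preimage Complex.imLm)

theorem segment_subset_gridSquare {δ : ℝ} (hδ : 0 < δ) {q : ℤ × ℤ} {e : (ℤ × ℤ) × (ℤ × ℤ)}
    (he : e ∈ squareEdges q) :
    segment ℝ (gridPoint δ e.1) (gridPoint δ e.2) ⊆ gridSquare δ q := by
  obtain ⟨a, b⟩ := q
  simp only [squareEdges, Finset.mem_insert, Finset.mem_singleton] at he
  refine (convex_gridSquare δ _).segment_subset ?_ ?_ <;>
  rcases he with rfl | rfl | rfl | rfl <;>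
  simp [gridSquare, gridPoint, Complex.mem_reProdIm, hδ.le, mul_add]

theorem balancedEdges_biUnion_squareEdges (A : Finset (ℤ × ℤ)) :
    BalancedEdges (A.biUnion squareEdges) := fun f => by
  rw [Finset.sum_biUnion fun q _ q' _ h => disjoint_squareEdges h]
  refine Finset.sum_eq_zero fun q _ => ?_
  rw [sum_squareEdges]
  ring

/-- Half-open edges can meet only at a common start or along antiparallel copies of one side. The
first case leaves a' and b' free, since at parameter 0 distinct edges may leave the same vertex. -/
theorem gridEdge_eq_or_eq_swap {δ : ℝ} (hδ : 0 < δ) {a a' b b' : ℤ × ℤ} (ha : IsGridStep a a')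
    (hb : IsGridStep b b') {s t : ℝ} (hs : s ∈ Ico (0 : ℝ) 1) (ht : t ∈ Ico (0 : ℝ) 1)
    (h : gridPoint δ a + s * (gridPoint δ a' - gridPoint δ a) =
      gridPoint δ b + t * (gridPoint δ b' - gridPoint δ b)) :
    (a = b ∧ s = t) ∨ (a = b' ∧ a' = b) := by
  obtain ⟨hs0, hs1⟩ := hs
  obtain ⟨ht0, ht1⟩ := ht
  have hre : (a.1 : ℝ) + s * (a'.1 - a.1) = b.1 + t * (b'.1 - b.1) := by
    have := congrArg Complex.re h
    simp [gridPoint] at this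
    refine mul_left_cancel₀ hδ.ne' ?_
    linear_combination this
  have him : (a.2 : ℝ) + s * (a'.2 - a.2) = b.2 + t * (b'.2 - b.2) := by
    have := congrArg Complex.im h
    simp [gridPoint] at this
    refine mul_left_cancel₀ hδ.ne' ?_
    linear_combination this
  obtain ⟨a1, a2⟩ := a
  obtain ⟨b1, b2⟩ := b
  obtain ⟨d1, hd1⟩ : ∃ d1 : ℤ, b1 = a1 + d1 := ⟨b1 - a1, by ring⟩
  obtain ⟨d2, hd2⟩ : ∃ d2 : ℤ, b2 = a2 + d2 := ⟨b2 - a2, by ring⟩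
  subst hd1 hd2
  -- Parameters below 1 keep each coordinate difference of the two starting points strictly between
  -- -2 and 2, so finitely many configurations remain.
  have key : ∀ d : ℤ, -2 < (d : ℝ) → (d : ℝ) < 2 → d = -1 ∨ d = 0 ∨ d = 1 := fun d h1 h2 => by
    have h3 : -2 < d := by exact_mod_cast h1
    have h4 : d < 2 := by exact_mod_cast h2
    omega
  rcases ha with rfl | rfl | rfl | rfl <;> rcases hb with rfl | rfl | rfl | rfl <;>
    push_cast at hre him <;>
    rcases key d1 (by linarith) (by linarith) with rfl | rfl | rfl <;>
    rcases key d2 (by linarith) (by linarith) with rfl | rfl | rfl <;>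
    push_cast at hre him <;>
    first
    | (exfalso; linarith)
    | exact Or.inl ⟨by simp, by linarith⟩
    | exact Or.inr ⟨by simp, by simp [sub_eq_add_neg]⟩

theorem swap_notMem_squareEdges {q : ℤ × ℤ} {e : (ℤ × ℤ) × (ℤ × ℤ)} (he : e ∈ squareEdges q) :
    e.swap ∉ squareEdges q := by
  obtain ⟨a, b⟩ := q
  simp only [squareEdges, Finset.mem_insert, Finset.mem_singleton] at he ⊢
  rcases he with rfl | rfl | rfl | rfl <;> simp

/-- The interior of a grid square. -/
def openGridSquare (δ : ℝ) (q : ℤ × ℤ) : Set ℂ :=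
  Ioo (δ * q.1) (δ * (q.1 + 1)) ×ℂ Ioo (δ * q.2) (δ * (q.2 + 1))

theorem eq_of_mem_openGridSquare {δ : ℝ} (hδ : 0 < δ) {q q' : ℤ × ℤ} {w : ℂ}
    (hw : w ∈ openGridSquare δ q) (hw' : w ∈ gridSquare δ q') : q = q' := by
  have key : ∀ m m' : ℤ, ∀ x : ℝ, x ∈ Ioo (δ * m) (δ * (m + 1)) →
      x ∈ Icc (δ * m') (δ * (m' + 1)) → m = m' := fun m m' x hx hx' => by
    have h1 : (m : ℝ) < m' + 1 := lt_of_mul_lt_mul_left (hx.1.trans_le hx'.2) hδ.le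
    have h2 : (m' : ℝ) < m + 1 := lt_of_mul_lt_mul_left (hx'.1.trans_lt hx.2) hδ.le
    have h3 : m < m' + 1 := by exact_mod_cast h1
    have h4 : m' < m + 1 := by exact_mod_cast h2
    omega
  exact Prod.ext (key _ _ _ hw.1 hw'.1) (key _ _ _ hw.2 hw'.2)

/-- A side also belongs to the closed neighbouring square, which an open square never meets. -/
theorem notMem_segment_of_mem_openGridSquare {δ : ℝ} (hδ : 0 < δ) {q : ℤ × ℤ} {w : ℂ}
    (hw : w ∈ openGridSquare δ q) {e : (ℤ × ℤ) × (ℤ × ℤ)} (he : e ∈ squareEdges q) :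
    w ∉ segment ℝ (gridPoint δ e.1) (gridPoint δ e.2) := fun hmem => by
  obtain ⟨q', hq'⟩ := exists_swap_mem_squareEdges he
  have h1 : w ∈ gridSquare δ q' := segment_subset_gridSquare hδ hq' (by
    rw [segment_symm]
    exact hmem)
  rw [← eq_of_mem_openGridSquare hδ hw h1] at hq'
  exact swap_notMem_squareEdges he hq'

theorem gridSquare_subset_closure {δ : ℝ} (hδ : 0 < δ) (q : ℤ × ℤ) :
    gridSquare δ q ⊆ closure (openGridSquare δ q) := by
  have h : ∀ m : ℤ, δ * m ≠ δ * (m + 1) := fun m => by nlinarith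
  rw [openGridSquare, Complex.closure_reProdIm, closure_Ioo (h _), closure_Ioo (h _)]
  rfl

theorem exists_mem_gridSquare {δ : ℝ} (hδ : 0 < δ) (z : ℂ) : ∃ q, z ∈ gridSquare δ q := by
  have key : ∀ x : ℝ, x ∈ Icc (δ * ⌊x / δ⌋) (δ * (⌊x / δ⌋ + 1)) := fun x => by
    constructor
    · rw [← le_div_iff₀' hδ]
      exact Int.floor_le _
    · rw [← div_le_iff₀' hδ]
      exact (Int.lt_floor_add_one _).le
  exact ⟨(⌊z.re / δ⌋, ⌊z.im / δ⌋), key _, key _⟩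

theorem dist_le_of_mem_gridSquare {δ : ℝ} {q : ℤ × ℤ} {z w : ℂ}
    (hz : z ∈ gridSquare δ q) (hw : w ∈ gridSquare δ q) : dist z w ≤ 2 * δ := by
  rw [dist_eq_norm]
  refine (Complex.norm_le_abs_re_add_abs_im _).trans ?_
  obtain ⟨⟨a1, a2⟩, a3, a4⟩ := hz
  obtain ⟨⟨b1, b2⟩, b3, b4⟩ := hw
  have h1 : |(z - w).re| ≤ δ := by
    rw [Complex.sub_re, abs_le]
    constructor <;> linarith
  have h2 : |(z - w).im| ≤ δ := by
    rw [Complex.sub_im, abs_le]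
    constructor <;> linarith
  linarith

theorem finite_setOf_gridSquare_inter_nonempty {δ : ℝ} (hδ : 0 < δ) {E : Set ℂ}
    (hE : Bornology.IsBounded E) : {q | (gridSquare δ q ∩ E).Nonempty}.Finite := by
  obtain ⟨R, hR⟩ := hE.subset_closedBall 0
  have key : ∀ m : ℤ, ∀ x : ℝ, |x| ≤ R → x ∈ Icc (δ * m) (δ * (m + 1)) →
      m ∈ Icc (⌊-R / δ⌋ - 1) ⌈R / δ⌉ := fun m x hx hm => by
    rw [abs_le] at hx
    constructor
    · have h1 : -R / δ ≤ m + 1 := by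
        rw [div_le_iff₀' hδ]
        linarith [hm.2]
      have h2 : (⌊-R / δ⌋ : ℝ) ≤ ((m + 1 : ℤ) : ℝ) := by
        push_cast
        exact (Int.floor_le _).trans h1
      have h3 : ⌊-R / δ⌋ ≤ m + 1 := by exact_mod_cast h2
      omega
    · have h1 : (m : ℝ) ≤ R / δ := by
        rw [le_div_iff₀' hδ]
        linarith [hm.1]
      exact_mod_cast h1.trans (Int.le_ceil _)
  refine ((finite_Icc (⌊-R / δ⌋ - 1) ⌈R / δ⌉).prod (finite_Icc (⌊-R / δ⌋ - 1) ⌈R / δ⌉)).subset ?_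
  rintro q ⟨z, hz, hzE⟩
  have hzR : ‖z‖ ≤ R := by simpa using hR hzE
  exact ⟨key _ _ ((Complex.abs_re_le_norm z).trans hzR) hz.1,
    key _ _ ((Complex.abs_im_le_norm z).trans hzR) hz.2⟩

end Grid

/-! ### Cauchy's theorem and formula for a grid square. -/

section SquareIntegrals

theorem continuousOn_comp_segment {f : ℂ → ℂ} {a b : ℂ} (hf : ContinuousOn f (segment ℝ a b)) :
    ContinuousOn (fun s : ℝ => f (a + s * (b - a))) (Icc 0 1) :=
  hf.comp (by fun_prop) fun _ hs => segment_point_mem hs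

theorem intervalIntegrable_edge {f : ℂ → ℂ} {a b : ℂ} (hf : ContinuousOn f (segment ℝ a b)) :
    IntervalIntegrable (fun s : ℝ => f (a + s * (b - a)) * (b - a)) volume 0 1 := by
  refine ContinuousOn.intervalIntegrable ?_
  rw [uIcc_of_le zero_le_one]
  exact (continuousOn_comp_segment hf).mul continuousOn_const

theorem edgeIntegral_add {f g : ℂ → ℂ} {a b : ℂ} (hf : ContinuousOn f (segment ℝ a b))
    (hg : ContinuousOn g (segment ℝ a b)) :
    edgeIntegral (fun z => f z + g z) a b = edgeIntegral f a b + edgeIntegral g a b := by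
  unfold edgeIntegral
  rw [← intervalIntegral.integral_add (intervalIntegrable_edge hf) (intervalIntegrable_edge hg)]
  simp only [add_mul]

theorem edgeIntegral_const_mul (c : ℂ) (f : ℂ → ℂ) (a b : ℂ) :
    edgeIntegral (fun z => c * f z) a b = c * edgeIntegral f a b := by
  unfold edgeIntegral
  rw [← intervalIntegral.integral_const_mul]
  simp only [mul_assoc]

theorem edgeIntegral_congr {f g : ℂ → ℂ} {a b : ℂ} (h : EqOn f g (segment ℝ a b)) :
    edgeIntegral f a b = edgeIntegral g a b := by
  refine intervalIntegral.integral_congr fun s hs => ?_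
  rw [uIcc_of_le zero_le_one] at hs
  simp only [h (segment_point_mem hs)]

theorem edgeIntegral_vertical (f : ℂ → ℂ) (x y y' : ℝ) :
    edgeIntegral f ⟨x, y⟩ ⟨x, y'⟩ = Complex.I • ∫ t in y..y', f (x + t * Complex.I) := by
  have h := intervalIntegral.smul_integral_comp_add_mul (a := 0) (b := 1)
    (fun t : ℝ => f (x + t * Complex.I)) (y' - y) y
  simp only [mul_zero, add_zero, mul_one, add_sub_cancel] at h
  rw [← h, edgeIntegral, intervalIntegral.integral_mul_const, Complex.real_smul, smul_eq_mul]
  have h1 : ((⟨x, y'⟩ : ℂ) - ⟨x, y⟩) = ((y' - y : ℝ) : ℂ) * Complex.I := by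
    apply Complex.ext <;> simp
  have h2 : ∀ s : ℝ, (⟨x, y⟩ : ℂ) + s * (((y' - y : ℝ) : ℂ) * Complex.I) =
      x + ((y + (y' - y) * s : ℝ) : ℂ) * Complex.I := fun s => by
    apply Complex.ext <;> simp [mul_comm]
  simp only [h1, h2]
  ring

theorem edgeIntegral_horizontal (f : ℂ → ℂ) (x x' y : ℝ) :
    edgeIntegral f ⟨x, y⟩ ⟨x', y⟩ = ∫ t in x..x', f (t + y * Complex.I) := by
  have h := intervalIntegral.smul_integral_comp_add_mul (a := 0) (b := 1)
    (fun t : ℝ => f (t + y * Complex.I)) (x' - x) x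
  simp only [mul_zero, add_zero, mul_one, add_sub_cancel] at h
  rw [← h, edgeIntegral, intervalIntegral.integral_mul_const, Complex.real_smul]
  have h1 : ((⟨x', y⟩ : ℂ) - ⟨x, y⟩) = ((x' - x : ℝ) : ℂ) := by
    apply Complex.ext <;> simp
  have h2 : ∀ s : ℝ, (⟨x, y⟩ : ℂ) + s * ((x' - x : ℝ) : ℂ) =
      ((x + (x' - x) * s : ℝ) : ℂ) + y * Complex.I := fun s => by
    apply Complex.ext <;> simp [mul_comm]
  simp only [h1, h2]
  ring

/-- The integral of `f` over the clockwise boundary of a grid square. -/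
def squareIntegral (δ : ℝ) (q : ℤ × ℤ) (f : ℂ → ℂ) : ℂ :=
  ∑ e ∈ squareEdges q, edgeIntegral f (gridPoint δ e.1) (gridPoint δ e.2)

theorem squareIntegral_eq_zero {δ : ℝ} (hδ : 0 < δ) {q : ℤ × ℤ} {f : ℂ → ℂ}
    (hf : DifferentiableOn ℂ f (gridSquare δ q)) : squareIntegral δ q f = 0 := by
  have hle : ∀ m : ℤ, δ * m ≤ δ * (m + 1) := fun m => by nlinarith
  have h := Complex.integral_boundary_rect_eq_zero_of_differentiableOn f
    (gridPoint δ q) (gridPoint δ (q.1 + 1, q.2 + 1)) (by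
      simp only [gridPoint]
      push_cast
      rwa [uIcc_of_le (hle _), uIcc_of_le (hle _)])
  rw [squareIntegral, sum_squareEdges]
  simp only [gridPoint, edgeIntegral_vertical, edgeIntegral_horizontal] at h ⊢
  rw [intervalIntegral.integral_symm (δ * ((q.2 : ℤ) : ℝ)),
    intervalIntegral.integral_symm (δ * ((q.1 : ℤ) : ℝ))]
  simp only [smul_eq_mul] at h ⊢
  -- The rectangle theorem integrates counterclockwise, the grid square clockwise.
  linear_combination -h

/-- After division by a - w the segment runs from 1 to a non-real point and so avoids the branch
cut. The principal logarithm is a primitive along it. -/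
theorem edgeIntegral_inv_sub {a b w : ℂ} (h : ((b - w) / (a - w)).im ≠ 0) :
    edgeIntegral (fun z => (z - w)⁻¹) a b = Complex.log ((b - w) / (a - w)) := by
  set r := (b - w) / (a - w) with hr
  have haw : a - w ≠ 0 := fun h0 => by simp [hr, h0] at h
  have hslit : ∀ s ∈ Icc (0 : ℝ) 1, 1 + (s : ℂ) * (r - 1) ∈ Complex.slitPlane := fun s _ => by
    rcases eq_or_ne s 0 with rfl | hs
    · simp
    · refine Or.inr ?_
      simpa using ⟨hs, h⟩
  have hder : ∀ s ∈ uIcc (0 : ℝ) 1, HasDerivAt (fun s : ℝ => Complex.log (1 + (s : ℂ) * (r - 1)))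
      ((a + s * (b - a) - w)⁻¹ * (b - a)) s := fun s hs => by
    rw [uIcc_of_le zero_le_one] at hs
    have h1 : HasDerivAt (fun s : ℝ => 1 + (s : ℂ) * (r - 1)) (r - 1) s := by
      simpa using ((hasDerivAt_id' s).ofReal_comp.mul_const (r - 1)).const_add 1
    have h2 := h1.clog_real (hslit s hs)
    convert h2 using 1
    have h3 : 1 + (s : ℂ) * (r - 1) = (a + s * (b - a) - w) / (a - w) := by
      rw [hr]; field_simp; ring
    have h4 : r - 1 = (b - a) / (a - w) := by rw [hr]; field_simp; ring
    have h5 : a + s * (b - a) - w ≠ 0 := fun h0 => by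
      have := Complex.slitPlane_ne_zero (hslit s hs)
      rw [h3, h0, zero_div] at this
      exact this rfl
    rw [h3, h4]
    field_simp
  have hne : ∀ s ∈ Icc (0 : ℝ) 1, a + (s : ℂ) * (b - a) - w ≠ 0 := fun s hs h0 => by
    have h3 : 1 + (s : ℂ) * (r - 1) = (a + s * (b - a) - w) / (a - w) := by
      rw [hr]; field_simp; ring
    have := Complex.slitPlane_ne_zero (hslit s hs)
    rw [h3, h0, zero_div] at this
    exact this rfl
  have hFTC := intervalIntegral.integral_eq_sub_of_hasDerivAt hder (by
    refine ContinuousOn.intervalIntegrable ?_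
    rw [uIcc_of_le zero_le_one]
    exact (ContinuousOn.inv₀ (by fun_prop) hne).mul continuousOn_const)
  rw [edgeIntegral, hFTC]
  simp

theorem im_div_neg {z w : ℂ} (h : z.im * w.re - z.re * w.im < 0) : (z / w).im < 0 := by
  have hw : 0 < Complex.normSq w := by
    rw [Complex.normSq_pos]
    rintro rfl
    simp at h
  rw [Complex.div_im, ← sub_div]
  exact div_neg_of_neg_of_pos h hw

/-- The four edges give logarithms whose arguments multiply to 1, so their sum is 2πi n. Each has
imaginary part in (-π, 0) because the sides are run clockwise around w, which forces n = -1. -/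
theorem squareIntegral_inv_sub {δ : ℝ} {q : ℤ × ℤ} {w : ℂ}
    (hw : w ∈ openGridSquare δ q) :
    squareIntegral δ q (fun z => (z - w)⁻¹) = -(2 * Real.pi * Complex.I) := by
  obtain ⟨⟨hx0, hx1⟩, hy0, hy1⟩ := hw
  set P := gridPoint δ q - w with hP
  set Q := gridPoint δ (q.1, q.2 + 1) - w with hQ
  set R := gridPoint δ (q.1 + 1, q.2 + 1) - w with hR
  set S := gridPoint δ (q.1 + 1, q.2) - w with hS
  have h1 : (Q / P).im < 0 := by
    refine im_div_neg ?_
    simp only [hP, hQ, gridPoint, Complex.sub_re, Complex.sub_im]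
    push_cast
    nlinarith
  have h2 : (R / Q).im < 0 := by
    refine im_div_neg ?_
    simp only [hR, hQ, gridPoint, Complex.sub_re, Complex.sub_im]
    push_cast
    nlinarith
  have h3 : (S / R).im < 0 := by
    refine im_div_neg ?_
    simp only [hR, hS, gridPoint, Complex.sub_re, Complex.sub_im]
    push_cast
    nlinarith
  have h4 : (P / S).im < 0 := by
    refine im_div_neg ?_
    simp only [hP, hS, gridPoint, Complex.sub_re, Complex.sub_im]
    push_cast
    nlinarith
  have hP0 : P ≠ 0 := fun h => by simp [h] at h1
  have hQ0 : Q ≠ 0 := fun h => by simp [h] at h2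
  have hR0 : R ≠ 0 := fun h => by simp [h] at h3
  have hS0 : S ≠ 0 := fun h => by simp [h] at h4
  rw [squareIntegral, sum_squareEdges, edgeIntegral_inv_sub h1.ne, edgeIntegral_inv_sub h2.ne,
    edgeIntegral_inv_sub h3.ne, edgeIntegral_inv_sub h4.ne]
  set l := Complex.log (Q / P) + (Complex.log (R / Q) + (Complex.log (S / R) + Complex.log (P / S)))
    with hl
  have hexp : Complex.exp l = 1 := by
    rw [hl, Complex.exp_add, Complex.exp_add, Complex.exp_add,
      Complex.exp_log (div_ne_zero hQ0 hP0), Complex.exp_log (div_ne_zero hR0 hQ0),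
      Complex.exp_log (div_ne_zero hS0 hR0), Complex.exp_log (div_ne_zero hP0 hS0)]
    field_simp
  obtain ⟨n, hn⟩ := Complex.exp_eq_one_iff.1 hexp
  have him : l.im = (Q / P).arg + ((R / Q).arg + ((S / R).arg + (P / S).arg)) := by
    simp [hl, Complex.log_im]
  have him2 : l.im = n * (2 * Real.pi) := by
    rw [hn]
    simp
  have hpi := Real.pi_pos
  have harg : ∀ z : ℂ, z.im < 0 → -Real.pi < z.arg ∧ z.arg < 0 := fun z hz =>
    ⟨Complex.neg_pi_lt_arg z, Complex.arg_neg_iff.2 hz⟩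
  have hn1 : n = -1 := by
    obtain ⟨a1, b1⟩ := harg _ h1
    obtain ⟨a2, b2⟩ := harg _ h2
    obtain ⟨a3, b3⟩ := harg _ h3
    obtain ⟨a4, b4⟩ := harg _ h4
    have hlt : (n : ℝ) < 0 := by
      by_contra hge
      have : 0 ≤ (n : ℝ) * (2 * Real.pi) := mul_nonneg (not_lt.1 hge) (by positivity)
      linarith
    have hgt : (-2 : ℝ) < n := by
      by_contra hge
      have : (n : ℝ) * (2 * Real.pi) ≤ -2 * (2 * Real.pi) :=
        mul_le_mul_of_nonneg_right (not_lt.1 hge) (by positivity)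
      linarith
    have e1 : n < 0 := by exact_mod_cast hlt
    have e2 : -2 < n := by exact_mod_cast hgt
    omega
  rw [hn, hn1]
  push_cast
  ring

/-- Split f(z)/(z - w) into the divided difference of f at w, which is differentiable and integrates
to 0, and f(w)/(z - w). -/
theorem squareIntegral_mul_inv_sub {δ : ℝ} (hδ : 0 < δ) {q : ℤ × ℤ} {w : ℂ}
    (hw : w ∈ openGridSquare δ q) {f : ℂ → ℂ}
    (hf : DifferentiableOn ℂ f (gridSquare δ q)) :
    squareIntegral δ q (fun z => f z * (z - w)⁻¹) = -(2 * Real.pi * Complex.I) * f w := by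
  have hnhds : gridSquare δ q ∈ 𝓝 w := by
    refine Filter.mem_of_superset ((isOpen_Ioo.reProdIm isOpen_Ioo).mem_nhds hw) ?_
    exact fun z hz => ⟨Ioo_subset_Icc_self hz.1, Ioo_subset_Icc_self hz.2⟩
  have hd := (Complex.differentiableOn_dslope hnhds).2 hf
  have hsum : squareIntegral δ q (fun z => f z * (z - w)⁻¹) =
      squareIntegral δ q (dslope f w) + f w * squareIntegral δ q (fun z => (z - w)⁻¹) := by
    unfold squareIntegral
    rw [Finset.mul_sum, ← Finset.sum_add_distrib]
    refine Finset.sum_congr rfl fun e he => ?_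
    have hne : ∀ z ∈ segment ℝ (gridPoint δ e.1) (gridPoint δ e.2), z - w ≠ 0 := fun z hz h0 =>
      notMem_segment_of_mem_openGridSquare hδ hw he (by rwa [← sub_eq_zero.1 h0])
    rw [← edgeIntegral_const_mul, ← edgeIntegral_add]
    · refine edgeIntegral_congr fun z hz => ?_
      have h1 := sub_smul_dslope f w z
      have := hne z hz
      rw [smul_eq_mul] at h1
      field_simp
      linear_combination -h1
    · exact hd.continuousOn.mono (segment_subset_gridSquare hδ he)
    · exact continuousOn_const.mul (ContinuousOn.inv₀ (by fun_prop) hne)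
  rw [hsum, squareIntegral_eq_zero hδ hd, squareIntegral_inv_sub hw]
  ring

end SquareIntegrals

/-! ### A contour separating a compact set from a closed set. -/

section SeparatingContour

/-- Dominated convergence, with |z - w| bounded below for w near y. It carries Cauchy's formula to
points on grid lines. -/
theorem continuousAt_edgeIntegral_mul_inv_sub {f : ℂ → ℂ} {a b y : ℂ}
    (hf : ContinuousOn f (segment ℝ a b)) (hy : y ∉ segment ℝ a b) :
    ContinuousAt (fun w => edgeIntegral (fun z => f z * (z - w)⁻¹) a b) y := by
  have hcl : IsClosed (segment ℝ a b) := by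
    rw [segment_eq_image']
    exact (isCompact_Icc.image (by fun_prop)).isClosed
  obtain ⟨r, hr, hball⟩ := Metric.isOpen_iff.1 hcl.isOpen_compl y hy
  have hdist : ∀ z ∈ segment ℝ a b, ∀ w ∈ Metric.ball y (r / 2), r / 2 ≤ ‖z - w‖ :=
    fun z hz w hw => by
      have h1 : r ≤ dist z y := by
        by_contra hlt
        exact hball (Metric.mem_ball.2 (not_le.1 hlt)) hz
      have h2 := dist_triangle z w y
      rw [Metric.mem_ball] at hw
      rw [← dist_eq_norm]
      linarith
  have hnhds : ∀ᶠ w in 𝓝 y, w ∈ Metric.ball y (r / 2) := Metric.ball_mem_nhds y (by positivity)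
  unfold edgeIntegral
  refine intervalIntegral.continuousAt_of_dominated_interval
    (bound := fun s => ‖f (a + s * (b - a))‖ * (r / 2)⁻¹ * ‖b - a‖) ?_ ?_ ?_ ?_
  · filter_upwards [hnhds] with w hw
    rw [uIoc_of_le zero_le_one]
    refine (intervalIntegrable_edge (f := fun z => f z * (z - w)⁻¹) (a := a) (b := b)
      ?_).aestronglyMeasurable
    refine hf.mul (ContinuousOn.inv₀ (by fun_prop) fun z hz h0 => ?_)
    have := hdist z hz w hw
    rw [h0, norm_zero] at this
    linarith
  · filter_upwards [hnhds] with w hw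
    refine Filter.Eventually.of_forall fun s hs => ?_
    rw [uIoc_of_le zero_le_one] at hs
    have := hdist _ (segment_point_mem (a := a) (b := b) (Ioc_subset_Icc_self hs)) w hw
    rw [norm_mul, norm_mul, norm_inv]
    gcongr
  · refine ContinuousOn.intervalIntegrable ?_
    rw [uIcc_of_le zero_le_one]
    exact ((continuousOn_comp_segment hf).norm.mul continuousOn_const).mul continuousOn_const
  · refine Filter.Eventually.of_forall fun s hs => ?_
    rw [uIoc_of_le zero_le_one] at hs
    have hmem := segment_point_mem (a := a) (b := b) (Ioc_subset_Icc_self hs)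
    refine ContinuousAt.mul (continuousAt_const.mul (ContinuousAt.inv₀ (by fun_prop) ?_))
      continuousAt_const
    exact fun h0 => hy (by rwa [← sub_eq_zero.1 h0])

/-- A balanced set of grid edges without antiparallel pairs is the edge set of a contour. -/
theorem exists_contour_of_balancedEdges {δ : ℝ} (hδ : 0 < δ) {S : Finset ((ℤ × ℤ) × (ℤ × ℤ))}
    (hS : BalancedEdges S) (hstep : ∀ e ∈ S, IsGridStep e.1 e.2) (hswap : ∀ e ∈ S, e.swap ∉ S) :
    ∃ Γ : Contour,
      (∀ γ ∈ Γ, ∀ t ∈ Icc (0 : ℝ) 1, ∃ e ∈ S,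
        γ.toFun t ∈ segment ℝ (gridPoint δ e.1) (gridPoint δ e.2)) ∧
      ∀ f : ℂ → ℂ, (∀ e ∈ S, ContinuousOn f (segment ℝ (gridPoint δ e.1) (gridPoint δ e.2))) →
        Γ.integral f = ∑ e ∈ S, edgeIntegral f (gridPoint δ e.1) (gridPoint δ e.2) := by
  obtain ⟨L, hL, hsum⟩ := hS.exists_cycles
  have hinj : ∀ c ∈ L, ∀ i < c.1, ∀ j < c.1, ∀ s ∈ Ico (0 : ℝ) 1, ∀ t ∈ Ico (0 : ℝ) 1,
      gridPoint δ (c.2 i) + s * (gridPoint δ (c.2 (i + 1)) - gridPoint δ (c.2 i)) =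
        gridPoint δ (c.2 j) + t * (gridPoint δ (c.2 (j + 1)) - gridPoint δ (c.2 j)) →
      i = j ∧ s = t := fun c hc i hi j hj s hs t ht h => by
    have hci := (hL c hc).mem i hi
    have hcj := (hL c hc).mem j hj
    -- A common starting vertex forces equal indices because the cycle is simple; the antiparallel
    -- case is excluded by `hswap`.
    rcases gridEdge_eq_or_eq_swap hδ (hstep _ hci) (hstep _ hcj) hs ht h with h1 | h1
    · exact ⟨(hL c hc).injOn hi hj h1.1, h1.2⟩
    · refine absurd ?_ (hswap _ hci)
      have h2 : (c.2 i, c.2 (i + 1)).swap = (c.2 j, c.2 (j + 1)) := Prod.ext h1.2 h1.1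
      rwa [h2]
  let curve : {c // c ∈ L} → JordanCurve := fun c =>
    polylineCurve (fun i => gridPoint δ (c.1.2 i)) c.1.1 (hL c.1 c.2).pos
      (congrArg _ (hL c.1 c.2).closed) (hinj c.1 c.2)
  refine ⟨L.attach.map curve, ?_, fun f hf => ?_⟩
  · intro γ hγ t ht
    obtain ⟨c, -, rfl⟩ := List.mem_map.1 hγ
    obtain ⟨i, hi, hmem⟩ := polyline_mem_segment (fun i => gridPoint δ (c.1.2 i))
      (hL c.1 c.2).pos ht
    exact ⟨_, (hL c.1 c.2).mem i hi, hmem⟩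
  · rw [hsum fun e => edgeIntegral f (gridPoint δ e.1) (gridPoint δ e.2), Contour.integral,
      List.map_map, ← List.attach_map_val (f := fun c : ℕ × (ℕ → ℤ × ℤ) => ∑ i ∈ Finset.range c.1,
        edgeIntegral f (gridPoint δ (c.2 i)) (gridPoint δ (c.2 (i + 1))))]
    congr 1
    refine List.map_congr_left fun c _ => ?_
    have hc : ∀ i < c.1.1, ContinuousOn f
        (segment ℝ (gridPoint δ (c.1.2 i)) (gridPoint δ (c.1.2 (i + 1)))) := fun i hi =>
      hf (c.1.2 i, c.1.2 (i + 1)) ((hL c.1 c.2).mem i hi)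
    exact integral_polyline (fun i => gridPoint δ (c.1.2 i)) (hL c.1 c.2).pos f hc

/-- A compact set `E` and a closed set `F` are separated by a contour `Γ` with winding number
`-1` about `E` and `0` about `F`; it comes with the edges of a polygon that it traverses, and with
Cauchy's formula for functions differentiable off `F`. -/
theorem exists_separating_contour {E F : Set ℂ} (hE : IsCompact E) (hF : IsClosed F)
    (hEF : Disjoint E F) :
    ∃ (Γ : Contour) (S : Finset ((ℤ × ℤ) × (ℤ × ℤ))) (P : ℤ × ℤ → ℂ),
      (∀ γ ∈ Γ, ∀ t ∈ Icc (0 : ℝ) 1, γ.toFun t ∉ E ∧ γ.toFun t ∉ F) ∧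
      (∀ e ∈ S, Disjoint (segment ℝ (P e.1) (P e.2)) E ∧ Disjoint (segment ℝ (P e.1) (P e.2)) F) ∧
      (∀ f : ℂ → ℂ, (∀ e ∈ S, ContinuousOn f (segment ℝ (P e.1) (P e.2))) →
        Γ.integral f = ∑ e ∈ S, edgeIntegral f (P e.1) (P e.2)) ∧
      (∀ w ∈ F, Γ.integral (fun z => (z - w)⁻¹) = 0) ∧
      ∀ f : ℂ → ℂ, DifferentiableOn ℂ f Fᶜ → ∀ y ∈ E,
        Γ.integral (fun z => f z * (z - y)⁻¹) = -(2 * Real.pi * Complex.I) * f y := by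
  obtain ⟨d, hd, hdist⟩ : ∃ d > 0, ∀ y ∈ E, ∀ w ∈ F, d ≤ dist y w := by
    obtain ⟨r, hr, h⟩ := Metric.exists_pos_forall_lt_edist hE hF hEF
    refine ⟨r, hr, fun y hy w hw => ?_⟩
    have := (h y hy w hw).le
    rw [edist_nndist] at this
    exact_mod_cast this
  -- A square has diameter at most 2δ < d, so a square meeting E misses F.
  set δ := d / 3 with hδdef
  have hδ : 0 < δ := by positivity
  set A := (finite_setOf_gridSquare_inter_nonempty hδ hE.isBounded).toFinset with hA
  have hAmem : ∀ q, q ∈ A ↔ (gridSquare δ q ∩ E).Nonempty := fun q => by simp [hA]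
  have hAF : ∀ q ∈ A, gridSquare δ q ⊆ Fᶜ := fun q hq w hw hwF => by
    obtain ⟨y, hy, hyE⟩ := (hAmem q).1 hq
    have h1 := hdist y hyE w hwF
    have h2 := dist_le_of_mem_gridSquare hy hw
    linarith
  set S₀ := A.biUnion squareEdges with hS₀
  have hstep₀ : ∀ e ∈ S₀, IsGridStep e.1 e.2 := fun e he => by
    obtain ⟨q, -, hq⟩ := Finset.mem_biUnion.1 he
    exact isGridStep_of_mem_squareEdges hq
  have hloop : ∀ e ∈ S₀, e.1 ≠ e.2 := fun e he => (hstep₀ e he).ne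
  set S := reducedEdges S₀ with hSdef
  have hSS : S ⊆ S₀ := Finset.filter_subset _ _
  have hSsum : ∀ f : ℂ → ℂ, ∑ e ∈ S, edgeIntegral f (gridPoint δ e.1) (gridPoint δ e.2) =
      ∑ q ∈ A, squareIntegral δ q f := fun f => by
    rw [hSdef, sum_reducedEdges S₀ hloop _ fun e => edgeIntegral_swap f _ _, hS₀,
      Finset.sum_biUnion fun q _ q' _ h => disjoint_squareEdges h]
    rfl
  have hsegF : ∀ e ∈ S, Disjoint (segment ℝ (gridPoint δ e.1) (gridPoint δ e.2)) F :=
    fun e he => by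
      obtain ⟨q, hqA, hq⟩ := Finset.mem_biUnion.1 (hSS he)
      exact disjoint_left.2 fun z hz => hAF q hqA (segment_subset_gridSquare hδ hq hz)
  -- If a side met E, the square across it would be selected as well, and the side would have been
  -- cancelled.
  have hsegE : ∀ e ∈ S, Disjoint (segment ℝ (gridPoint δ e.1) (gridPoint δ e.2)) E :=
    fun e he => disjoint_left.2 fun z hz hzE => by
      obtain ⟨q, hqA, hq⟩ := Finset.mem_biUnion.1 (hSS he)
      obtain ⟨q', hq'⟩ := exists_swap_mem_squareEdges hq
      have hzq' : z ∈ gridSquare δ q' := segment_subset_gridSquare hδ hq' (by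
        rw [segment_symm]
        exact hz)
      exact (Finset.mem_filter.1 he).2
        (Finset.mem_biUnion.2 ⟨q', (hAmem q').2 ⟨z, hzq', hzE⟩, hq'⟩)
  obtain ⟨Γ, hΓmem, hΓint⟩ := exists_contour_of_balancedEdges hδ
    ((balancedEdges_biUnion_squareEdges A).reducedEdges hloop)
    (fun e he => hstep₀ e (hSS he))
    (fun e he h => (Finset.mem_filter.1 he).2 (hSS h))
  have hinv : ∀ w : ℂ, ∀ e ∈ S, w ∉ segment ℝ (gridPoint δ e.1) (gridPoint δ e.2) →
      ContinuousOn (fun z => (z - w)⁻¹) (segment ℝ (gridPoint δ e.1) (gridPoint δ e.2)) :=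
    fun w e _ hw => ContinuousOn.inv₀ (by fun_prop) fun z hz h0 => hw (by
      rwa [← sub_eq_zero.1 h0])
  refine ⟨Γ, S, gridPoint δ, ?_, fun e he => ⟨hsegE e he, hsegF e he⟩, hΓint, ?_, ?_⟩
  · intro γ hγ t ht
    obtain ⟨e, he, hmem⟩ := hΓmem γ hγ t ht
    exact ⟨disjoint_left.1 (hsegE e he) hmem, disjoint_left.1 (hsegF e he) hmem⟩
  · intro w hw
    rw [hΓint _ fun e he => hinv w e he (disjoint_right.1 (hsegF e he) hw), hSsum]
    refine Finset.sum_eq_zero fun q hq => squareIntegral_eq_zero hδ ?_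
    refine DifferentiableOn.inv (by fun_prop) fun z hz h0 => hAF q hq hz ?_
    rwa [sub_eq_zero.1 h0]
  · intro f hf y hy
    have hfc : ∀ e ∈ S, ContinuousOn f (segment ℝ (gridPoint δ e.1) (gridPoint δ e.2)) :=
      fun e he => hf.continuousOn.mono fun z hz => disjoint_left.1 (hsegF e he) hz
    -- The point y may lie on a cancelled grid line. The formula is checked at w in the open square
    -- q, where only q contributes, and w tends to y.
    obtain ⟨q, hq⟩ := exists_mem_gridSquare hδ y
    have hqA : q ∈ A := (hAmem q).2 ⟨y, hq, hy⟩
    rw [hΓint (fun z => f z * (z - y)⁻¹) fun e he => (hfc e he).mul (hinv y e he (disjoint_right.1 (hsegE e he) hy))]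
    have hcont : ContinuousAt (fun w => ∑ e ∈ S, edgeIntegral (fun z => f z * (z - w)⁻¹)
        (gridPoint δ e.1) (gridPoint δ e.2)) y :=
      tendsto_finsetSum _ fun e he => continuousAt_edgeIntegral_mul_inv_sub (hfc e he)
        (disjoint_right.1 (hsegE e he) hy)
    have hfy : ContinuousWithinAt (fun w => -(2 * Real.pi * Complex.I) * f w)
        (openGridSquare δ q) y := by
      refine continuousWithinAt_const.mul ((hf.continuousOn y (hAF q hqA hq)).mono ?_)
      exact fun z hz => hAF q hqA ⟨Ioo_subset_Icc_self hz.1, Ioo_subset_Icc_self hz.2⟩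
    have : (𝓝[openGridSquare δ q] y).NeBot :=
      mem_closure_iff_nhdsWithin_neBot.1 (gridSquare_subset_closure hδ q hq)
    refine tendsto_nhds_unique_of_eventuallyEq
      (hcont.continuousWithinAt (s := openGridSquare δ q)).tendsto hfy.tendsto ?_
    filter_upwards [self_mem_nhdsWithin] with w hw
    rw [hSsum, Finset.sum_eq_single_of_mem q hqA]
    · exact squareIntegral_mul_inv_sub hδ hw (hf.mono (hAF q hqA))
    · intro q' hq' hne
      refine squareIntegral_eq_zero hδ ((hf.mono (hAF q' hq')).mul ?_)
      refine DifferentiableOn.inv (by fun_prop) fun z hz h0 => hne ?_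
      rw [sub_eq_zero.1 h0] at hz
      exact (eq_of_mem_openGridSquare hδ hw hz).symm

end SeparatingContour

/-! ### Analyticity of Cauchy transforms on the sphere. -/

section CauchyTransform

theorem exists_linear_integrals {Y : Type*} [MeasurableSpace Y] {μ : Measure Y} {n : ℕ}
    (w : Fin n → Y → ℂ) (hw : ∀ i, ∀ g : Lp ℂ 2 μ, Integrable (fun y => w i y * g y) μ) :
    ∃ l : Lp ℂ 2 μ →ₗ[ℂ] (Fin n → ℂ), ∀ g i, l g i = ∫ y, w i y * g y ∂μ := by
  refine ⟨{ toFun := fun g i => ∫ y, w i y * g y ∂μ, map_add' := ?_, map_smul' := ?_ },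
    fun _ _ => rfl⟩
  · intro g₁ g₂
    ext i
    rw [Pi.add_apply, ← integral_add (hw i g₁) (hw i g₂)]
    refine integral_congr_ae ?_
    filter_upwards [Lp.coeFn_add g₁ g₂] with y hy
    rw [hy, Pi.add_apply, mul_add]
  · intro c g
    ext i
    rw [Pi.smul_apply, smul_eq_mul, RingHom.id_apply, ← integral_const_mul]
    refine integral_congr_ae ?_
    filter_upwards [Lp.coeFn_smul c g] with y hy
    rw [hy, Pi.smul_apply, smul_eq_mul]
    ring

/-- Differentiation under the integral sign. The form c - w d covers finite points (c = y, d = 1)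
and ∞ in the chart ζ = 1/z (c = 1, d = y). -/
theorem eventually_differentiableAt_integral_mul_inv {Y : Type*} [TopologicalSpace Y] [CompactSpace Y]
    [MeasurableSpace Y] [BorelSpace Y] {μ : Measure Y} {g : Y → ℂ} (hg : Integrable g μ)
    {c d : Y → ℂ} (hc : Continuous c) (hd : Continuous d) {w₀ : ℂ}
    (h0 : ∀ y, c y - w₀ * d y ≠ 0) :
    ∀ᶠ w in 𝓝 w₀, DifferentiableAt ℂ (fun w => ∫ y, g y * (c y - w * d y)⁻¹ ∂μ) w := by
  obtain ⟨m, hm, hlow⟩ : ∃ m > 0, ∀ y, m ≤ ‖c y - w₀ * d y‖ := by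
    rcases isEmpty_or_nonempty Y with hY | hY
    · exact ⟨1, one_pos, fun y => hY.elim y⟩
    · obtain ⟨y₀, -, hy₀⟩ := isCompact_univ.exists_isMinOn univ_nonempty
        (f := fun y => ‖c y - w₀ * d y‖) (by fun_prop)
      exact ⟨_, norm_pos_iff.2 (h0 y₀), fun y => hy₀ (mem_univ y)⟩
  obtain ⟨B, hB⟩ : ∃ B, ∀ y, ‖d y‖ ≤ B := by
    obtain ⟨B, hB⟩ := isCompact_univ.exists_bound_of_continuousOn (f := d) hd.continuousOn
    exact ⟨B, fun y => hB y (mem_univ y)⟩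
  have hB0 : 0 < |B| + 1 := by positivity
  -- Within r of w₀ the denominator changes by at most m/2, half of its lower bound. The summand 1
  -- keeps the divisor positive.
  set r := m / 2 / (|B| + 1) with hr
  have hr0 : 0 < r := by positivity
  have hlow' : ∀ w ∈ Metric.ball w₀ r, ∀ y, m / 2 ≤ ‖c y - w * d y‖ := fun w hw y => by
    have h1 : c y - w₀ * d y = (c y - w * d y) + (w - w₀) * d y := by ring
    have h2 : ‖(w - w₀) * d y‖ ≤ r * (|B| + 1) := by
      rw [norm_mul]
      gcongr
      · rw [← dist_eq_norm]
        exact (Metric.mem_ball.1 hw).le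
      · linarith [hB y, le_abs_self B]
    have h3 : r * (|B| + 1) = m / 2 := by rw [hr]; field_simp
    have h4 := hlow y
    rw [h1] at h4
    linarith [norm_add_le (c y - w * d y) ((w - w₀) * d y)]
  have hne : ∀ w ∈ Metric.ball w₀ r, ∀ y, c y - w * d y ≠ 0 := fun w hw y h => by
    have := hlow' w hw y
    rw [h, norm_zero] at this
    linarith
  have hmeas : ∀ w ∈ Metric.ball w₀ r, Continuous fun y => (c y - w * d y)⁻¹ := fun w hw =>
    Continuous.inv₀ (by fun_prop) (hne w hw)
  filter_upwards [Metric.ball_mem_nhds w₀ hr0] with w hw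
  refine (hasDerivAt_integral_of_dominated_loc_of_deriv_le (𝕜 := ℂ)
    (F := fun w y => g y * (c y - w * d y)⁻¹)
    (F' := fun w y => g y * (d y * ((c y - w * d y)⁻¹) ^ 2))
    (bound := fun y => ‖g y‖ * ((|B| + 1) * ((m / 2)⁻¹) ^ 2))
    (Metric.isOpen_ball.mem_nhds hw) ?_ ?_ ?_ ?_ ?_ ?_).2.differentiableAt
  · filter_upwards [Metric.isOpen_ball.mem_nhds hw] with v hv
    exact hg.aestronglyMeasurable.mul (hmeas v hv).aestronglyMeasurable
  · refine hg.mul_bdd (c := (m / 2)⁻¹) (hmeas w hw).aestronglyMeasurable ?_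
    refine Filter.Eventually.of_forall fun y => ?_
    rw [norm_inv]
    have := hlow' w hw y
    gcongr
  · exact hg.aestronglyMeasurable.mul (hd.mul ((hmeas w hw).pow 2)).aestronglyMeasurable
  · refine Filter.Eventually.of_forall fun y v hv => ?_
    rw [norm_mul, norm_mul, norm_pow, norm_inv]
    have := hlow' v hv y
    gcongr
    linarith [hB y, le_abs_self B]
  · exact hg.norm.mul_const _
  · refine Filter.Eventually.of_forall fun y v hv => ?_
    have h1 : HasDerivAt (fun v => c y - v * d y) (-d y) v := by
      simpa using ((hasDerivAt_id' v).mul_const (d y)).const_sub (c y)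
    have h2 := (h1.fun_inv (hne v hv y)).const_mul (g y)
    rw [neg_neg, div_eq_mul_inv, ← inv_pow] at h2
    exact h2

theorem analyticAt_integral_mul_inv {Y : Type*} [TopologicalSpace Y] [CompactSpace Y]
    [MeasurableSpace Y] [BorelSpace Y] {μ : Measure Y} {g : Y → ℂ} (hg : Integrable g μ)
    {c d : Y → ℂ} (hc : Continuous c) (hd : Continuous d) {w₀ : ℂ}
    (h0 : ∀ y, c y - w₀ * d y ≠ 0) :
    AnalyticAt ℂ (fun w => ∫ y, g y * (c y - w * d y)⁻¹ ∂μ) w₀ :=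
  Complex.analyticAt_iff_eventually_differentiableAt.2
    (eventually_differentiableAt_integral_mul_inv hg hc hd h0)

variable {E : Set ℂ}

/-- The Cauchy transform `z ↦ ∫ g(y) / (y - z) dμ(y)`, which is `0` at `∞`. -/
def cauchyTransform (μ : Measure E) (g : E → ℂ) : OnePoint ℂ → ℂ
  | none => 0
  | some z => ∫ y : E, g y * ((y : ℂ) - z)⁻¹ ∂μ

theorem sphereAnalyticAt_cauchyTransform [CompactSpace E] {μ : Measure E} {g : E → ℂ}
    (hg : Integrable g μ) {z : OnePoint ℂ} (hz : ∀ y ∈ E, (y : OnePoint ℂ) ≠ z) :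
    SphereAnalyticAt (cauchyTransform μ g) z := by
  match z with
  | some w =>
    change AnalyticAt ℂ (fun ζ : ℂ => ∫ y : E, g y * ((y : ℂ) - ζ)⁻¹ ∂μ) w
    have := analyticAt_integral_mul_inv hg (c := fun y : E => (y : ℂ)) (d := fun _ => 1)
      (by fun_prop) (by fun_prop) (w₀ := w) fun y h => hz y y.2 (by
        rw [mul_one, sub_eq_zero] at h
        rw [h]; rfl)
    simpa only [mul_one] using this
  | none =>
    change AnalyticAt ℂ (fun ζ => cauchyTransform μ g (sphereInv ζ)) 0
    have h1 := analyticAt_integral_mul_inv hg (c := fun _ => 1) (d := fun y : E => (y : ℂ))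
      (by fun_prop) (by fun_prop) (w₀ := 0) (by simp)
    -- This is 1/(y - 1/ζ) = -ζ/(1 - ζy); the factor ζ also yields the value 0 at ∞.
    have h2 : (fun ζ => cauchyTransform μ g (sphereInv ζ)) =
        fun ζ => (-ζ) * ∫ y : E, g y * (1 - ζ * (y : ℂ))⁻¹ ∂μ := by
      funext ζ
      unfold sphereInv
      split_ifs with h
      · simp [h, cauchyTransform]
      · change ∫ y : E, g y * ((y : ℂ) - ζ⁻¹)⁻¹ ∂μ = _
        rw [← integral_const_mul]
        congr 1
        funext y
        have h3 : (y : ℂ) - ζ⁻¹ = (-ζ)⁻¹ * (1 - ζ * y) := by field_simp; ring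
        rw [h3, mul_inv, inv_inv]
        ring
    rw [h2]
    exact analyticAt_id.neg.mul h1

/-- Needed for measurability of Cauchy transforms on F. At ∞ it uses that 1/w tends to 0 as w leaves
bounded sets. -/
theorem SphereAnalyticAt.continuousAt {f : OnePoint ℂ → ℂ} {z : OnePoint ℂ}
    (h : SphereAnalyticAt f z) : ContinuousAt f z := by
  match z with
  | some w => exact OnePoint.continuousAt_coe.2 (AnalyticAt.continuousAt h)
  | none =>
    have h1 : ContinuousAt (fun ζ => f (sphereInv ζ)) 0 := AnalyticAt.continuousAt h
    refine OnePoint.continuousAt_infty'.2 ?_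
    rw [Filter.coclosedCompact_eq_cocompact, ← Metric.cobounded_eq_cocompact]
    have h2 := h1.tendsto.comp Filter.tendsto_inv₀_cobounded
    have h3 : f (sphereInv 0) = f OnePoint.infty := by simp [sphereInv]
    rw [h3] at h2
    refine h2.congr' ?_
    filter_upwards [Bornology.eventually_ne_cobounded (0 : ℂ)] with w hw
    simp [sphereInv, hw]

end CauchyTransform

/-! ### The Zolotarev kernel as a rank n perturbation of the Cauchy kernel. -/

section ZolotarevKernel

variable {E : Set ℂ}

/-- Division of r by X - y: the quotient's coefficients are polynomials in y. Its degree is below n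
even for constant r because n ≥ 1. -/
theorem exists_eval_sub_eval_eq (r : Polynomial ℂ) {n : ℕ} (hn : 1 ≤ n) (hr : r.natDegree ≤ n) :
    ∃ c : ℕ → ℂ → ℂ, (∀ j, Continuous (c j)) ∧
      ∀ y z, r.eval z - r.eval y = (z - y) * ∑ j ∈ Finset.range n, c j y * z ^ j := by
  refine ⟨fun j y => (r /ₘ (Polynomial.X - Polynomial.C y)).coeff j, fun j => ?_, fun y z => ?_⟩
  · simp only [Polynomial.coeff_divByMonic_X_sub_C]
    fun_prop
  · have h1 := Polynomial.modByMonic_add_div r (Polynomial.X - Polynomial.C y)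
    rw [Polynomial.modByMonic_X_sub_C_eq_C_eval] at h1
    have h2 := congrArg (Polynomial.eval z) h1
    have h3 : (r /ₘ (Polynomial.X - Polynomial.C y)).natDegree < n := by
      rw [Polynomial.natDegree_divByMonic _ (Polynomial.monic_X_sub_C y),
        Polynomial.natDegree_X_sub_C]
      omega
    rw [← Polynomial.eval_eq_sum_range' h3, ← h2]
    simp

theorem ratFunc_eval_eq (φ : RatFunc ℂ) (z : ℂ) :
    φ.eval (RingHom.id ℂ) z = φ.num.eval z / φ.denom.eval z := by
  simp [RatFunc.eval]

theorem integrable_mul_of_continuous {Y : Type*} [TopologicalSpace Y] [CompactSpace Y]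
    [MeasurableSpace Y] [BorelSpace Y] {μ : Measure Y} {w g : Y → ℂ} (hw : Continuous w)
    (hg : Integrable g μ) : Integrable (fun y => w y * g y) μ := by
  obtain ⟨B, hB⟩ := isCompact_univ.exists_bound_of_continuousOn hw.continuousOn
  exact hg.bdd_mul (c := B) hw.aestronglyMeasurable
    (Filter.Eventually.of_forall fun y => hB y (mem_univ y))

theorem continuous_inv_sub_of_notMem {z : ℂ} (hz : z ∉ E) :
    Continuous fun y : E => ((y : ℂ) - z)⁻¹ :=
  Continuous.inv₀ (by fun_prop) fun y h => hz (by rw [← sub_eq_zero.1 h]; exact y.2)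

theorem exists_fin_roots (q : Polynomial ℂ) (hq : q ≠ 0) {n : ℕ} (hn : q.natDegree ≤ n) :
    ∃ r : Fin n → ℂ, ∀ z, q.eval z = 0 → ∃ i, r i = z := by
  refine ⟨fun i => q.roots.toList.getD i 0, fun z hz => ?_⟩
  have hmem : z ∈ q.roots.toList := Multiset.mem_toList.2 ((Polynomial.mem_roots hq).2 hz)
  obtain ⟨i, hi, h⟩ := List.getElem_of_mem hmem
  have hlen : q.roots.toList.length ≤ n := by
    rw [Multiset.length_toList]
    exact (Polynomial.card_roots' q).trans hn
  exact ⟨⟨i, by omega⟩, by rw [← h]; exact List.getD_eq_getElem _ _ hi⟩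

/-- The Zolotarev kernel is a rank `n` perturbation of the Cauchy kernel, so the two integral
operators agree on a subspace of codimension at most `n`. -/
theorem exists_eLpNorm_cauchyTransform_le [CompactSpace E] {F : Set (OnePoint ℂ)}
    (hEF : ∀ y ∈ E, (y : OnePoint ℂ) ∉ F) (μ : Measure E) [IsFiniteMeasure μ] (ν : Measure F)
    (p : ℝ≥0∞) {n : ℕ} (hn : 1 ≤ n) (φ : RatFunc ℂ) (hnum : φ.num.natDegree ≤ n)
    (hden : φ.denom.natDegree ≤ n) (hE : ∀ᵐ y : E ∂μ, φ.denom.eval (y : ℂ) ≠ 0)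
    (hF : ∀ᵐ z : F ∂ν, NonvanishingAt φ z) {M : ℝ≥0∞}
    (hM : ∀ g : E → ℂ, MemLp g 2 μ →
      (∀ᵐ z : F ∂ν, Integrable (fun y : E => zolotarevKernel φ z y * g y) μ) ∧
      eLpNorm (fun z : F => ∫ y : E, zolotarevKernel φ z y * g y ∂μ) p ν ≤ M * eLpNorm g 2 μ) :
    ∃ l : Lp ℂ 2 μ →ₗ[ℂ] (Fin n → ℂ), ∀ g : Lp ℂ 2 μ, l g = 0 →
      eLpNorm (fun z : F => cauchyTransform μ g z) p ν ≤ M * eLpNorm g 2 μ := by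
  have hgint : ∀ g : Lp ℂ 2 μ, Integrable (fun y => g y) μ := fun g =>
    (Lp.memLp g).integrable (by norm_num)
  have hnotE : ∀ z : ℂ, (z : OnePoint ℂ) ∈ F → z ∉ E := fun z hz hzE => hEF z hzE hz
  -- The natural functionals integrate g against multiples of φ, so they exist on all of L² only if
  -- φg is always integrable.
  by_cases hφ : ∀ g : Lp ℂ 2 μ, Integrable (fun y : E => φ.eval (RingHom.id ℂ) y * g y) μ
  · obtain ⟨cp, hcp, hcp'⟩ := exists_eval_sub_eval_eq φ.num hn hnum
    obtain ⟨cq, hcq, hcq'⟩ := exists_eval_sub_eval_eq φ.denom hn hden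
    have hwint : ∀ j, ∀ g : Lp ℂ 2 μ, Integrable (fun y : E =>
        (cq j y * φ.eval (RingHom.id ℂ) y - cp j y) * g y) μ := fun j g => by
      have h1 := integrable_mul_of_continuous ((hcq j).comp continuous_subtype_val) (hφ g)
      have h2 := integrable_mul_of_continuous ((hcp j).comp continuous_subtype_val) (hgint g)
      refine (h1.sub h2).congr (Filter.Eventually.of_forall fun y => ?_)
      simp only [Pi.sub_apply, Function.comp_apply]
      ring
    obtain ⟨l, hl⟩ := exists_linear_integrals (μ := μ) (n := n)
      (fun j y => cq j y * φ.eval (RingHom.id ℂ) y - cp j y) (fun j g => hwint j g)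
    refine ⟨l, fun g hg => ?_⟩
    refine le_trans (le_of_eq ?_) (hM g (Lp.memLp g)).2
    refine eLpNorm_congr_ae ?_
    filter_upwards [hF] with z hz
    obtain ⟨z, hzF⟩ := z
    match z, hzF, hz with
    -- At ∞ both the Cauchy transform and the Zolotarev kernel are 0 by convention.
    | none, _, _ =>
      change (0 : ℂ) = ∫ y : E, (0 : ℂ) * g y ∂μ
      simp
    | some z, hzF, hz =>
      have hz0 : φ.num.eval z ≠ 0 := hz
      have hzE := hnotE z hzF
      have h1 := integrable_mul_of_continuous (continuous_inv_sub_of_notMem hzE) (hgint g)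
      have h2 : ∀ j ∈ Finset.range n, Integrable (fun y : E => z ^ j / φ.num.eval z *
          ((cq j y * φ.eval (RingHom.id ℂ) y - cp j y) * g y)) μ := fun j _ =>
        (hwint j g).const_mul _
      -- With φ = P/Q and divided differences A of P and B of Q, the identity is φ(y)/(φ(z)(y - z))
      -- = 1/(y - z) - (Bφ(y) - A)/P(z). At a pole z of φ the factor 1/φ(z) = Q(z)/P(z) is 0 on both
      -- readings.
      have h3 : ∫ y : E, zolotarevKernel φ (some z) y * g y ∂μ =
          ∫ y : E, (((y : ℂ) - z)⁻¹ * g y - ∑ j ∈ Finset.range n, z ^ j / φ.num.eval z *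
            ((cq j y * φ.eval (RingHom.id ℂ) y - cp j y) * g y)) ∂μ := by
        refine integral_congr_ae ?_
        filter_upwards [hE] with y hy
        have hyz : (y : ℂ) - z ≠ 0 := fun h => hzE (by rw [← sub_eq_zero.1 h]; exact y.2)
        have e1 := hcp' y z
        have e2 := hcq' y z
        have e3 : ∑ j ∈ Finset.range n, z ^ j / φ.num.eval z *
            ((cq j y * φ.eval (RingHom.id ℂ) y - cp j y) * g y) =
            ((∑ j ∈ Finset.range n, cq j y * z ^ j) * φ.eval (RingHom.id ℂ) y -
              ∑ j ∈ Finset.range n, cp j y * z ^ j) * (g y / φ.num.eval z) := by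
          rw [Finset.sum_mul, ← Finset.sum_sub_distrib, Finset.sum_mul]
          refine Finset.sum_congr rfl fun j _ => ?_
          ring
        rw [e3]
        set A := ∑ j ∈ Finset.range n, cp j y * z ^ j
        set B := ∑ j ∈ Finset.range n, cq j y * z ^ j
        simp only [zolotarevKernel, ratFunc_eval_eq, inv_div]
        field_simp
        linear_combination g y * (φ.num.eval (y : ℂ) * e2 - φ.denom.eval (y : ℂ) * e1)
      have h4 : ∫ y : E, ∑ j ∈ Finset.range n, z ^ j / φ.num.eval z *
          ((cq j y * φ.eval (RingHom.id ℂ) y - cp j y) * g y) ∂μ = 0 := by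
        rw [integral_finsetSum _ h2]
        refine Finset.sum_eq_zero fun j hj => ?_
        rw [integral_const_mul, ← hl g ⟨j, Finset.mem_range.1 hj⟩, hg, Pi.zero_apply, mul_zero]
      change ∫ y : E, g y * ((y : ℂ) - z)⁻¹ ∂μ = ∫ y : E, zolotarevKernel φ (some z) y * g y ∂μ
      rw [h3, integral_sub h1 (integrable_finsetSum _ h2), h4, sub_zero]
      simp only [mul_comm]
  · push Not at hφ
    obtain ⟨g₀, hg₀⟩ := hφ
    -- Where φ(z) is finite and nonzero, multiplying the integrable function by φ(z)(y - z), bounded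
    -- in y, would make φg₀ integrable. So ν-almost every finite z is a pole of φ.
    have hsupp : ∀ᵐ z : F ∂ν, ∀ w : ℂ, (z : OnePoint ℂ) = w → φ.denom.eval w = 0 := by
      filter_upwards [hF, (hM g₀ (Lp.memLp g₀)).1] with z hz hint w hw
      by_contra hne
      apply hg₀
      obtain ⟨z, hzF⟩ := z
      subst hw
      have hw0 : φ.num.eval w ≠ 0 := hz
      have hwE := hnotE w hzF
      have h1 := integrable_mul_of_continuous (μ := μ)
        (w := fun y : E => φ.num.eval w / φ.denom.eval w * ((y : ℂ) - w)) (by fun_prop) hint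
      refine h1.congr (Filter.Eventually.of_forall fun y => ?_)
      have hyw : (y : ℂ) - w ≠ 0 := fun h => hwE (by rw [← sub_eq_zero.1 h]; exact y.2)
      change φ.num.eval w / φ.denom.eval w * ((y : ℂ) - w) *
        ((φ.eval (RingHom.id ℂ) w)⁻¹ * φ.eval (RingHom.id ℂ) y / (y - w) * g₀ y) = _
      rw [ratFunc_eval_eq φ w]
      field_simp
    obtain ⟨r, hr⟩ := exists_fin_roots φ.denom φ.denom_ne_zero hden
    classical
    -- The functionals evaluate the Cauchy transform at the poles. A pole in E may give a divergent
    -- integral, but it is not in F, so 0 serves there.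
    obtain ⟨l, hl⟩ := exists_linear_integrals (μ := μ) (n := n)
      (fun j y => if r j ∈ E then 0 else ((y : ℂ) - r j)⁻¹) (fun j g => by
        split_ifs with h
        · simp
        · exact integrable_mul_of_continuous (continuous_inv_sub_of_notMem h) (hgint g))
    refine ⟨l, fun g hg => ?_⟩
    have h0 : (fun z : F => cauchyTransform μ g z) =ᵐ[ν] fun _ => (0 : ℂ) := by
      filter_upwards [hsupp] with z hz
      obtain ⟨z, hzF⟩ := z
      match z, hzF, hz with
      | none, _, _ => rfl
      | some w, hzF, hz =>
        obtain ⟨i, rfl⟩ := hr w (hz w rfl)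
        have h1 := hl g i
        rw [hg, Pi.zero_apply] at h1
        simp only [hnotE _ hzF, if_false] at h1
        change ∫ y : E, g y * ((y : ℂ) - r i)⁻¹ ∂μ = 0
        rw [h1]
        simp only [mul_comm]
    rw [eLpNorm_congr_ae h0]
    simp

end ZolotarevKernel

/-! ### The identity 𝒦'[Cg] = 𝒦g. -/

section GrothendieckDual

variable {E : Set ℂ}

/-- Fubini: the segment misses E, so the Cauchy kernel is continuous on a compact product. The sign
comes from replacing y - z by z - y. -/
theorem edgeIntegral_mul_cauchyTransform [CompactSpace E] (μ : Measure E) [IsFiniteMeasure μ]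
    {g : E → ℂ} (hg : Integrable g μ) {f : ℂ → ℂ} {a b : ℂ}
    (hf : ContinuousOn f (segment ℝ a b)) (hE : Disjoint (segment ℝ a b) E) :
    Integrable (fun y : E => g y * edgeIntegral (fun z => f z * (z - y)⁻¹) a b) μ ∧
    edgeIntegral (fun z => f z * cauchyTransform μ g z) a b =
      - ∫ y : E, g y * edgeIntegral (fun z => f z * (z - y)⁻¹) a b ∂μ := by
  let pt : Icc (0 : ℝ) 1 → ℂ := fun s => a + (s : ℝ) * (b - a)
  have hpt : ∀ s, pt s ∈ segment ℝ a b := fun s => segment_point_mem s.2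
  have hfpt : Continuous fun s => f (pt s) := hf.comp_continuous (by fun_prop) hpt
  let k : C(Icc (0 : ℝ) 1 × E, ℂ) :=
    { toFun := fun q => f (pt q.1) * (pt q.1 - q.2)⁻¹ * (b - a)
      continuous_toFun := by
        refine ((hfpt.comp continuous_fst).mul (Continuous.inv₀ (by fun_prop) ?_)).mul
          continuous_const
        intro q h
        refine disjoint_left.1 hE (hpt q.1) ?_
        rw [sub_eq_zero.1 h]
        exact q.2.2 }
  -- Projecting s to [0,1] extends the kernel continuously to all real s without changing it on the
  -- range of integration.
  let K : ℝ → E → ℂ := fun s y => k (projIcc 0 1 zero_le_one s, y) * g y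
  have : IsFiniteMeasure (volume.restrict (uIoc (0 : ℝ) 1)) := by
    rw [uIoc_of_le zero_le_one]
    infer_instance
  have hK : Integrable (Function.uncurry K) ((volume.restrict (uIoc (0 : ℝ) 1)).prod μ) := by
    refine (hg.comp_snd _).bdd_mul (c := ‖k‖) ?_ ?_
    · refine Continuous.aestronglyMeasurable (f := fun q : ℝ × E =>
        k (projIcc 0 1 zero_le_one q.1, q.2)) ?_
      have := continuous_projIcc (a := (0 : ℝ)) (b := 1) (h := zero_le_one)
      fun_prop
    · exact Filter.Eventually.of_forall fun q => k.norm_coe_le_norm _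
  have hk : ∀ s ∈ Icc (0 : ℝ) 1, ∀ y : E, K s y =
      f (a + s * (b - a)) * (a + s * (b - a) - y)⁻¹ * (b - a) * g y := fun s hs y => by
    simp only [K, projIcc_of_mem zero_le_one hs]
    rfl
  have hin : ∀ y : E, ∫ s in (0 : ℝ)..1, K s y =
      g y * edgeIntegral (fun z => f z * (z - y)⁻¹) a b := fun y => by
    rw [edgeIntegral, ← intervalIntegral.integral_const_mul]
    refine intervalIntegral.integral_congr fun s hs => ?_
    rw [uIcc_of_le zero_le_one] at hs
    simp only [hk s hs y]
    ring
  constructor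
  · have h1 := hK.integral_prod_right
    simp only [Function.uncurry_apply_pair, uIoc_of_le (zero_le_one (α := ℝ))] at h1
    refine h1.congr (Filter.Eventually.of_forall fun y => ?_)
    simp only
    rw [← hin, intervalIntegral.integral_of_le zero_le_one]
  · have hswap := intervalIntegral_integral_swap hK
    simp only [hin] at hswap
    rw [← hswap, edgeIntegral, ← intervalIntegral.integral_neg]
    refine intervalIntegral.integral_congr fun s hs => ?_
    rw [uIcc_of_le zero_le_one] at hs
    simp only [hk s hs]
    change f (a + s * (b - a)) * (∫ y : E, g y * ((y : ℂ) - (a + s * (b - a)))⁻¹ ∂μ) * (b - a) = _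
    rw [mul_right_comm, ← integral_const_mul, ← integral_neg]
    refine integral_congr_ae (Filter.Eventually.of_forall fun y => ?_)
    simp only
    rw [← neg_sub (a + s * (b - a)) (y : ℂ), inv_neg]
    ring

/-- The Grothendieck dual maps the Cauchy transform of `g` to `𝒦 g`. -/
theorem grothendieckDual_cauchyTransform {D : Type*} [MetricSpace D] [CompactSpace D]
    [MeasurableSpace D] [BorelSpace D] [CompactSpace E] {F : Set (OnePoint ℂ)} (hF : IsClosed F)
    (hEF : ∀ y ∈ E, (y : OnePoint ℂ) ∉ F) (lam : Measure D) [IsFiniteMeasure lam]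
    (μ : Measure E) [IsFiniteMeasure μ] (ν : Measure F) (p : ℝ≥0∞) [Fact (1 ≤ p)]
    (K : C(D × E, ℂ)) (Kext : D → OnePoint ℂ → ℂ)
    (hK : ∀ (x : D) (y : E), Kext x ((y : ℂ) : OnePoint ℂ) = K (x, y))
    (hanal : ∀ x : D, ∀ z ∈ Fᶜ, SphereAnalyticAt (Kext x) z)
    {T : bergman F p ν →L[ℂ] Lp ℂ 2 lam} (hT : IsGrothendieckDual E F p ν lam Kext T)
    (g : Lp ℂ 2 μ) (u : bergman F p ν)
    (hu : (u : Lp ℂ p ν) =ᵐ[ν] fun z : F => cauchyTransform μ g z) :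
    T u = kernelOp lam μ K g := by
  have hg : Integrable (fun y => g y) μ := (Lp.memLp g).integrable (by norm_num)
  have hEc : IsCompact E := isCompact_iff_compactSpace.2 inferInstance
  set F' : Set ℂ := (fun z : ℂ => (z : OnePoint ℂ)) ⁻¹' F with hF'
  have hF'c : IsClosed F' := hF.preimage OnePoint.continuous_coe
  obtain ⟨Γ, S, P, hΓ, hS, hint, hind, hcauchy⟩ := exists_separating_contour hEc hF'c
    (disjoint_left.2 fun y hy => hEF y hy)
  set U : Set (OnePoint ℂ) := ((fun z : ℂ => (z : OnePoint ℂ)) '' E)ᶜ with hU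
  have hUopen : IsOpen U := (hEc.image OnePoint.continuous_coe).isClosed.isOpen_compl
  have hFU : F ⊆ U := by
    rintro z hz ⟨y, hy, rfl⟩
    exact hEF y hy hz
  have hpi : (2 * Real.pi * Complex.I : ℂ) ≠ 0 := Complex.two_pi_I_ne_zero
  -- The clockwise contour has index 0 on F, as it must when ∞ ∈ F, and -1 on E; hence a = -1.
  have hadm : Γ.Admissible F U := by
    refine ⟨fun γ hγ t ht => ⟨?_, (hΓ γ hγ t ht).2⟩, -1, ?_, ?_⟩
    · rintro ⟨y, hy, h⟩
      rw [OnePoint.coe_injective h] at hy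
      exact (hΓ γ hγ t ht).1 hy
    · intro z hz
      match z, hz with
      | none, _ => simp [Contour.index]
      | some w, hw =>
        change (2 * Real.pi * Complex.I : ℂ)⁻¹ * Γ.integral (fun ξ => (ξ - w)⁻¹) = _
        rw [hind w hw]
        simp
    · intro w hw
      rw [hU, notMem_compl_iff] at hw
      obtain ⟨y, hy, rfl⟩ := hw
      have h1 := hcauchy (fun _ => 1) (differentiableOn_const _) y hy
      simp only [one_mul, mul_one] at h1
      change (2 * Real.pi * Complex.I : ℂ)⁻¹ * Γ.integral (fun ξ => (ξ - y)⁻¹) = _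
      rw [h1, mul_neg, inv_mul_cancel₀ hpi]
      simp
  have hne : ∀ z ∈ U, ∀ y ∈ E, (y : OnePoint ℂ) ≠ z := fun z hz y hy h => hz ⟨y, hy, h⟩
  have hH : MemH U (cauchyTransform μ g) :=
    ⟨fun z hz => sphereAnalyticAt_cauchyTransform hg (hne z hz), fun _ => rfl⟩
  have hval : ∀ x, dualFun Kext Γ (cauchyTransform μ g) x = ∫ y, K (x, y) * g y ∂μ := fun x => by
    set f : ℂ → ℂ := fun z => Kext x (z : OnePoint ℂ) with hf
    have hfd : DifferentiableOn ℂ f F'ᶜ := fun z hz =>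
      (AnalyticAt.differentiableAt (hanal x z hz)).differentiableWithinAt
    have hfc : ∀ e ∈ S, ContinuousOn f (segment ℝ (P e.1) (P e.2)) := fun e he =>
      hfd.continuousOn.mono fun z hz => disjoint_left.1 (hS e he).2 hz
    have hcc : ∀ e ∈ S, ContinuousOn (fun z : ℂ => cauchyTransform μ g (z : OnePoint ℂ))
        (segment ℝ (P e.1) (P e.2)) := fun e he z hz => by
      have hzU : (z : OnePoint ℂ) ∈ U := by
        rintro ⟨y, hy, h⟩
        rw [OnePoint.coe_injective h] at hy
        exact disjoint_left.1 (hS e he).1 hz hy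
      exact (AnalyticAt.continuousAt
        (sphereAnalyticAt_cauchyTransform hg (hne _ hzU))).continuousWithinAt
    have hinv : ∀ y : E, ∀ e ∈ S, ContinuousOn (fun z => f z * (z - y)⁻¹)
        (segment ℝ (P e.1) (P e.2)) := fun y e he =>
      (hfc e he).mul (ContinuousOn.inv₀ (by fun_prop) fun z hz h0 =>
        disjoint_left.1 (hS e he).1 hz (by rw [sub_eq_zero.1 h0]; exact y.2))
    have h1 := fun e he => edgeIntegral_mul_cauchyTransform μ hg (hfc e he) (hS e he).1
    -- Two signs cancel: one from y - z against z - y, the other from the clockwise orientation in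
    -- Cauchy's formula.
    have h2 : Γ.integral (fun z => f z * cauchyTransform μ g (z : OnePoint ℂ)) =
        (2 * Real.pi * Complex.I) * ∫ y, K (x, y) * g y ∂μ := by
      rw [hint (fun z => f z * cauchyTransform μ g (z : OnePoint ℂ))
        fun e he => (hfc e he).mul (hcc e he),
        Finset.sum_congr rfl fun e he => (h1 e he).2, Finset.sum_neg_distrib,
        ← integral_finsetSum _ fun e he => (h1 e he).1, ← integral_neg, ← integral_const_mul]
      refine integral_congr_ae (Filter.Eventually.of_forall fun y => ?_)
      simp only
      rw [← Finset.mul_sum, ← hint _ (hinv y), hcauchy f hfd y y.2, hf]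
      simp only [hK]
      ring
    rw [dualFun, h2, inv_mul_cancel_left₀ hpi]
  have h3 := hT U (cauchyTransform μ g) Γ u hUopen hFU
    (fun y hy h => h ⟨y, hy, rfl⟩) hH hadm hu
  refine Lp.ext (h3.trans ?_)
  refine Filter.EventuallyEq.trans ?_ (coeFn_kernelOp lam μ K g).symm
  exact Filter.Eventually.of_forall hval

/-- If the Cauchy transform of `g` is in `L^p_ν(F)` then `‖𝒦 g‖ ≤ ‖𝒦'‖ ‖C g‖`. -/
theorem enorm_kernelOp_le {D : Type*} [MetricSpace D] [CompactSpace D]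
    [MeasurableSpace D] [BorelSpace D] [CompactSpace E] {F : Set (OnePoint ℂ)} (hF : IsClosed F)
    (hEF : ∀ y ∈ E, (y : OnePoint ℂ) ∉ F) (lam : Measure D) [IsFiniteMeasure lam]
    (μ : Measure E) [IsFiniteMeasure μ] (ν : Measure F) (p : ℝ≥0∞) [Fact (1 ≤ p)]
    (K : C(D × E, ℂ)) (Kext : D → OnePoint ℂ → ℂ)
    (hK : ∀ (x : D) (y : E), Kext x ((y : ℂ) : OnePoint ℂ) = K (x, y))
    (hanal : ∀ x : D, ∀ z ∈ Fᶜ, SphereAnalyticAt (Kext x) z)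
    {T : bergman F p ν →L[ℂ] Lp ℂ 2 lam} (hT : IsGrothendieckDual E F p ν lam Kext T)
    (g : Lp ℂ 2 μ) (hgp : eLpNorm (fun z : F => cauchyTransform μ g z) p ν ≠ ⊤) :
    ‖kernelOp lam μ K g‖ₑ ≤ ‖T‖ₑ * eLpNorm (fun z : F => cauchyTransform μ g z) p ν := by
  have hg : Integrable (fun y => g y) μ := (Lp.memLp g).integrable (by norm_num)
  have hEc : IsCompact E := isCompact_iff_compactSpace.2 inferInstance
  set U : Set (OnePoint ℂ) := ((fun z : ℂ => (z : OnePoint ℂ)) '' E)ᶜ with hU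
  have hUopen : IsOpen U := (hEc.image OnePoint.continuous_coe).isClosed.isOpen_compl
  have hFU : F ⊆ U := by
    rintro z hz ⟨y, hy, rfl⟩
    exact hEF y hy hz
  have han : ∀ z ∈ U, SphereAnalyticAt (cauchyTransform μ g) z := fun z hz =>
    sphereAnalyticAt_cauchyTransform hg fun y hy h => hz ⟨y, hy, h⟩
  have hcont : Continuous fun z : F => cauchyTransform μ g z := continuous_iff_continuousAt.2
    fun z => (han z (hFU z.2)).continuousAt.comp continuous_subtype_val.continuousAt
  have hmem : MemLp (fun z : F => cauchyTransform μ g z) p ν :=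
    ⟨hcont.measurable.aestronglyMeasurable, lt_top_iff_ne_top.2 hgp⟩
  let u : bergman F p ν := ⟨hmem.toLp _, Submodule.le_topologicalClosure _
    (Submodule.subset_span ⟨U, cauchyTransform μ g, hUopen, hFU, ⟨han, fun _ => rfl⟩,
      hmem.coeFn_toLp⟩)⟩
  rw [← grothendieckDual_cauchyTransform hF hEF lam μ ν p K Kext hK hanal hT g u hmem.coeFn_toLp,
    ← Lp.enorm_toLp hmem]
  exact T.le_opENorm u

end GrothendieckDual

end

/-! ### The main theorem. -/

theorem theorem1 {D : Type*} [MetricSpace D] [CompactSpace D] [MeasurableSpace D] [BorelSpace D]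
    (E : Set ℂ) [CompactSpace E] (F : Set (OnePoint ℂ)) (hF : IsClosed F)
    (hEF : ∀ y ∈ E, (y : OnePoint ℂ) ∉ F)
    (lam : Measure D) [IsFiniteMeasure lam] (μ : Measure E) [IsFiniteMeasure μ] (ν : Measure F)
    (p : ℝ≥0∞) [Fact (1 ≤ p)]
    (K : C(D × E, ℂ)) (Kext : D → OnePoint ℂ → ℂ)
    (hK : ∀ (x : D) (y : E), Kext x ((y : ℂ) : OnePoint ℂ) = K (x, y))
    (hcont : ContinuousOn (fun q : D × OnePoint ℂ => Kext q.1 q.2) (univ ×ˢ Fᶜ))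
    (hanal : ∀ x : D, ∀ z ∈ Fᶜ, SphereAnalyticAt (Kext x) z)
    (n : ℕ) (hn : 1 ≤ n)
    (hZ : cauchyZolotarev n E F p μ ν ≠ ⊤)
    (hK' : dualNorm E F p ν lam Kext ≠ ⊤) :
    ∃ Kn : C(D × E, ℂ),
      LinearMap.rank (kernelOp lam μ Kn : Lp ℂ 2 μ →ₗ[ℂ] Lp ℂ 2 lam) ≤ n ∧
      ‖kernelOp lam μ K - kernelOp lam μ Kn‖ₑ ≤
        cauchyZolotarev n E F p μ ν * dualNorm E F p ν lam Kext := by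
  set Z := cauchyZolotarev n E F p μ ν with hZdef
  set N := dualNorm E F p ν lam Kext with hNdef
  have hfin : Z * N ≠ ⊤ := ENNReal.mul_ne_top hZ hK'
  have key : ∀ c' > (Z * N).toReal, ∃ l : Lp ℂ 2 μ →ₗ[ℂ] (Fin n → ℂ), ∀ g, l g = 0 →
      ‖kernelOp lam μ K g‖ ≤ c' * ‖g‖ := by
    intro c' hc'
    have hc0 : 0 < c' := ENNReal.toReal_nonneg.trans_lt hc'
    have hlt : Z * N < ENNReal.ofReal c' := (ENNReal.lt_ofReal_iff_toReal_lt hfin).2 hc'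
    -- The infima defining Z and N need not be attained. Since both are finite, multiplication is
    -- continuous at (Z, N), and slightly larger a and b still have product below c'.
    obtain ⟨a, ha, b, hb, hab⟩ : ∃ a > Z, ∃ b > N, a * b < ENNReal.ofReal c' := by
      have htend : Filter.Tendsto (fun ε : ℝ≥0∞ => (Z + ε) * (N + ε)) (𝓝[>] 0) (𝓝 (Z * N)) := by
        have h1 : ∀ x : ℝ≥0∞, Filter.Tendsto (fun ε : ℝ≥0∞ => x + ε) (𝓝[>] 0) (𝓝 x) := fun x => by
          have : Filter.Tendsto (fun ε : ℝ≥0∞ => x + ε) (𝓝[>] 0) (𝓝 (x + 0)) :=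
            (continuous_const.add continuous_id).continuousAt.tendsto.mono_left nhdsWithin_le_nhds
          rwa [add_zero] at this
        exact ENNReal.Tendsto.mul (h1 Z) (Or.inr hK') (h1 N) (Or.inr hZ)
      obtain ⟨ε, hε, hε0⟩ := ((htend.eventually (gt_mem_nhds hlt)).and self_mem_nhdsWithin).exists
      have hε0' : ε ≠ 0 := (mem_Ioi.1 hε0).ne'
      exact ⟨Z + ε, ENNReal.lt_add_right hZ hε0', N + ε, ENNReal.lt_add_right hK' hε0', hε⟩
    obtain ⟨T, hT, hTb⟩ : ∃ T, IsGrothendieckDual E F p ν lam Kext T ∧ ‖T‖ₑ < b := by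
      simpa only [hNdef, dualNorm, gt_iff_lt, iInf_lt_iff, exists_prop] using hb
    obtain ⟨φ, hφ, hφa⟩ : ∃ φ : RatFunc ℂ, (φ ≠ 0 ∧ φ.num.natDegree ≤ n ∧
        φ.denom.natDegree ≤ n ∧ (∀ᵐ y : E ∂μ, φ.denom.eval (y : ℂ) ≠ 0) ∧
        ∀ᵐ z : F ∂ν, NonvanishingAt φ z) ∧
        kernelNorm p μ ν (fun (z : F) (y : E) => zolotarevKernel φ z y) < a := by
      simpa only [hZdef, cauchyZolotarev, gt_iff_lt, iInf_lt_iff, exists_prop] using ha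
    obtain ⟨-, hnum, hden, hE', hF'⟩ := hφ
    obtain ⟨M, hM, hMa⟩ := sInf_lt_iff.1 hφa
    obtain ⟨l, hl⟩ := exists_eLpNorm_cauchyTransform_le hEF μ ν p hn φ hnum hden hE' hF' hM
    refine ⟨l, fun g hg => ?_⟩
    have h1 := hl g hg
    have hMtop : M ≠ ⊤ := (hMa.trans_le le_top).ne
    -- On the kernel of l the Zolotarev bound makes ‖Cg‖ finite, which is what places Cg in the
    -- Bergman space.
    have h2 := enorm_kernelOp_le hF hEF lam μ ν p K Kext hK hanal hT g
      (ne_top_of_le_ne_top (ENNReal.mul_ne_top hMtop (Lp.eLpNorm_ne_top g)) h1)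
    have h3 : ‖kernelOp lam μ K g‖ₑ ≤ ENNReal.ofReal c' * ‖g‖ₑ := by
      refine h2.trans ?_
      calc ‖T‖ₑ * eLpNorm (fun z : F => cauchyTransform μ g z) p ν
          ≤ b * (a * eLpNorm g 2 μ) := by
            gcongr
            exact h1.trans (by gcongr)
        _ = a * b * eLpNorm g 2 μ := by ring
        _ ≤ ENNReal.ofReal c' * ‖g‖ₑ := by
            rw [Lp.enorm_def]
            gcongr
    rw [← ofReal_norm, ← ofReal_norm, ← ENNReal.ofReal_mul hc0.le] at h3
    exact (ENNReal.ofReal_le_ofReal_iff (by positivity)).1 h3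
  obtain ⟨Kn, hrank, hnorm⟩ := exists_kernelOp_rank_le lam μ K ENNReal.toReal_nonneg n key
  refine ⟨Kn, hrank, ?_⟩
  rw [← ofReal_norm, ← ENNReal.ofReal_toReal hfin]
  exact ENNReal.ofReal_le_ofReal hnorm
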